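/- Let $n\ge 1$. An $n$-dimensional special datum $\mathbb D=(D,w)$ consists of a set $D$ of non-empty subsets of $\{1,\dots,n\}$ and a function $w:D\to\mathbb N$ such that: (1) $\{i\}\in D$ for every $i\in\{1,\dots,n\}$; (2) for all $J,J'\in D$, either $J\subset J'$, or $J'\subset J$, or $J\cap J'=\emptyset$; (3) $w(J)=1$ for every element $J$ of $D$ that is maximal with respect to inclusion; (4) if $J,J'\in D$ and $J\subsetneq J'$, then $w(J)>w(J')$ and $w(J')\mid w(J)$; (5) if $J_1,J_2,J\in D$ with $J_1\sqsubset J$ and $J_2\sqsubset J$, then $w(J_1)=w(J_2)$, where $J'\sqsubset J$ means that $J'\subsetneq J$ and no $K\in D$ satisfies $J'\subsetneq K\subsetneq J$. For such a datum put $x_J=\prod_{j\in J}x_j$, let $R_{\mathbb D}=\mathbb C[x_J^{w(J)}\mid J\in D]\subset\mathbb C[x_1,\dots,x_n]$, and let $\mathfrak m_{\mathbb D}=(x_J^{w(J)}\mid J\in D)$, a maximal ideal of $R_{\mathbb D}$. Let $e(R_{\mathbb D})$ and $\mathrm{emb}(R_{\mathbb D})$ denote the Hilbert–Samuel multiplicity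 and the embedding dimension of the local ring $A=(R_{\mathbb D})_{\mathfrak m_{\mathbb D}}$ with maximal ideal $\mathfrak m$; that is, $e(R_{\mathbb D})=\lim_{k\to\infty}d!\,\ell_A(A/\mathfrak m^k)/k^d$ with $d=\dim A$, and $\mathrm{emb}(R_{\mathbb D})=\dim_{A/\mathfrak m}\mathfrak m/\mathfrak m^2$. Then for every $n$-dimensional special datum $\mathbb D$ the limit defining $e(R_{\mathbb D})$ exists, $$e(R_{\mathbb D})\le 2^{n-1},$$ and equality holds if and only if $\mathrm{emb}(R_{\mathbb D})=2n-1$. -/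

import Mathlib

open Filter Topology

noncomputable section

/-- The normalized Hilbert–Samuel function `k ↦ d! · ℓ_A(A / 𝔪 ^ k) / k ^ d` of a local ring
`(A, 𝔪)`, where `d` is the Krull dimension of `A`. -/
def normalizedHilbertSamuel (A : Type*) [CommRing A] [IsLocalRing A] (k : ℕ) : ℝ :=
  let d : ℕ := ((ringKrullDim A).unbotD 0).toNat
  (d.factorial : ℝ) *
      ((Module.length A (A ⧸ IsLocalRing.maximalIdeal A ^ k)).toNat : ℝ) / (k : ℝ) ^ d

/-- The Hilbert–Samuel multiplicity `lim_{k → ∞} d! · ℓ_A(A / 𝔪 ^ k) / k ^ d` of a local ring. -/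
def hilbertSamuelMultiplicity (A : Type*) [CommRing A] [IsLocalRing A] : ℝ :=
  limUnder atTop (normalizedHilbertSamuel A)

/-- The embedding dimension of a local ring: the dimension of `𝔪 / 𝔪 ^ 2` over the residue
field. -/
def embeddingDimension (A : Type*) [CommRing A] [IsLocalRing A] : ℕ :=
  Module.finrank (IsLocalRing.ResidueField A) (IsLocalRing.CotangentSpace A)

/-- An `n`-dimensional special datum. The index set `{1, …, n}` is `Fin n`. The weight is a total
function on subsets, of which only the values on members of `D` are ever used. -/
structure SpecialDatum (n : ℕ) where
  D : Finset (Finset (Fin n))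
  w : Finset (Fin n) → ℕ
  nonempty_of_mem : ∀ J ∈ D, J.Nonempty
  singleton_mem : ∀ i : Fin n, {i} ∈ D
  laminar : ∀ J ∈ D, ∀ J' ∈ D, J ⊆ J' ∨ J' ⊆ J ∨ Disjoint J J'
  w_maximal : ∀ J, Maximal (· ∈ D) J → w J = 1
  w_lt : ∀ J ∈ D, ∀ J' ∈ D, J ⊂ J' → w J' < w J
  w_dvd : ∀ J ∈ D, ∀ J' ∈ D, J ⊂ J' → w J' ∣ w J
  /-- Members of `D` directly below the same member of `D` have the same weight. -/
  w_eq : ∀ J₁ ∈ D, ∀ J₂ ∈ D, ∀ J ∈ D,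
    (J₁ ⊂ J ∧ ∀ K ∈ D, ¬ (J₁ ⊂ K ∧ K ⊂ J)) →
    (J₂ ⊂ J ∧ ∀ K ∈ D, ¬ (J₂ ⊂ K ∧ K ⊂ J)) → w J₁ = w J₂

namespace SpecialDatum

variable {n : ℕ} (𝔻 : SpecialDatum n)

/-- The monomial `x_J ^ w(J)`, where `x_J = ∏_{j ∈ J} x_j`. -/
def monomial (J : Finset (Fin n)) : MvPolynomial (Fin n) ℂ :=
  (∏ j ∈ J, MvPolynomial.X j) ^ 𝔻.w J

/-- The ring `R_𝔻 = ℂ[x_J ^ w(J) | J ∈ D]`, a subalgebra of `ℂ[x_1, …, x_n]`. -/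
def ring : Subalgebra ℂ (MvPolynomial (Fin n) ℂ) :=
  Algebra.adjoin ℂ {p | ∃ J ∈ 𝔻.D, p = 𝔻.monomial J}

/-- The ideal `𝔪_𝔻 = (x_J ^ w(J) | J ∈ D)` of `R_𝔻`. -/
def maxIdeal : Ideal 𝔻.ring :=
  Ideal.span {r | ∃ J ∈ 𝔻.D, (r : MvPolynomial (Fin n) ℂ) = 𝔻.monomial J}

theorem w_pos {J : Finset (Fin n)} (hJ : J ∈ 𝔻.D) : 0 < 𝔻.w J := by
  obtain ⟨K, hJK, hK⟩ := 𝔻.D.exists_le_maximal hJ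
  rcases eq_or_lt_of_le hJK with rfl | h
  · rw [𝔻.w_maximal _ hK]; exact one_pos
  · exact lt_of_le_of_lt (Nat.zero_le _) (𝔻.w_lt J hJ K hK.prop h)

/-- Evaluation at the origin, `R_𝔻 → ℂ`. -/
def evalZero : 𝔻.ring →+* ℂ :=
  (MvPolynomial.constantCoeff (R := ℂ) (σ := Fin n)).comp 𝔻.ring.val.toRingHom

theorem maxIdeal_eq_ker : 𝔻.maxIdeal = RingHom.ker 𝔻.evalZero := by
  apply le_antisymm
  · refine Ideal.span_le.2 ?_
    rintro r ⟨J, hJ, hr⟩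
    obtain ⟨j, hj⟩ := 𝔻.nonempty_of_mem J hJ
    change MvPolynomial.constantCoeff (r : MvPolynomial (Fin n) ℂ) = 0
    rw [hr, monomial, map_pow, map_prod, Finset.prod_eq_zero hj (by simp),
      zero_pow (𝔻.w_pos hJ).ne']
  · have key : ∀ p (hp : p ∈ 𝔻.ring), (⟨p, hp⟩ : 𝔻.ring) -
        algebraMap ℂ 𝔻.ring (MvPolynomial.constantCoeff p) ∈ 𝔻.maxIdeal := by
      intro p hp
      induction hp using Algebra.adjoin_induction with
      | mem x hx =>
        obtain ⟨J, hJ, rfl⟩ := hx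
        obtain ⟨j, hj⟩ := 𝔻.nonempty_of_mem J hJ
        have h0 : MvPolynomial.constantCoeff (𝔻.monomial J) = 0 := by
          rw [monomial, map_pow, map_prod, Finset.prod_eq_zero hj (by simp),
            zero_pow (𝔻.w_pos hJ).ne']
        rw [h0, map_zero, sub_zero]
        exact Ideal.subset_span ⟨J, hJ, rfl⟩
      | algebraMap r =>
        convert 𝔻.maxIdeal.zero_mem
        rw [sub_eq_zero]
        apply Subtype.ext
        simp [MvPolynomial.algebraMap_eq]
      | add x y hx hy ihx ihy =>
        have := 𝔻.maxIdeal.add_mem ihx ihy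
        convert this using 1
        rw [map_add, map_add]
        have e : (⟨x + y, add_mem hx hy⟩ : 𝔻.ring) = ⟨x, hx⟩ + ⟨y, hy⟩ := rfl
        refine Eq.trans (congrArg (· - _) e) ?_
        ring
      | mul x y hx hy ihx ihy =>
        have := 𝔻.maxIdeal.add_mem (𝔻.maxIdeal.mul_mem_right ⟨y, hy⟩ ihx)
          (𝔻.maxIdeal.mul_mem_left
            (algebraMap ℂ 𝔻.ring (MvPolynomial.constantCoeff x)) ihy)
        convert this using 1
        rw [map_mul, map_mul]
        have e : (⟨x * y, mul_mem hx hy⟩ : 𝔻.ring) = ⟨x, hx⟩ * ⟨y, hy⟩ := rfl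
        refine Eq.trans (congrArg (· - _) e) ?_
        ring
    intro r hr
    have h := key r.1 r.2
    have h0 : MvPolynomial.constantCoeff (r : MvPolynomial (Fin n) ℂ) = 0 := hr
    rw [h0, map_zero, sub_zero] at h
    exact h

instance maxIdeal_isPrime : 𝔻.maxIdeal.IsPrime := by
  rw [maxIdeal_eq_ker]
  exact RingHom.ker_isPrime _

/-- The local ring of `R_𝔻` at `𝔪_𝔻`. -/
abbrev LocalRing : Type := Localization.AtPrime 𝔻.maxIdeal

/-- `e(R_𝔻)`, the Hilbert–Samuel multiplicity of the local ring of `R_𝔻` at `𝔪_𝔻`. -/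
def e : ℝ := hilbertSamuelMultiplicity 𝔻.LocalRing

/-- `emb(R_𝔻)`, the embedding dimension of the local ring of `R_𝔻` at `𝔪_𝔻`. -/
def emb : ℕ := embeddingDimension 𝔻.LocalRing

end SpecialDatum

end

section Counting

/-- A function `ℕ → ℕ` that agrees with a rational polynomial for large arguments. -/
def EventuallyPoly (f : ℕ → ℕ) : Prop :=
  ∃ p : Polynomial ℚ, ∀ᶠ k : ℕ in atTop, (f k : ℚ) = p.eval (k : ℚ)

namespace EventuallyPoly

theorem const (a : ℕ) : EventuallyPoly fun _ => a :=
  ⟨Polynomial.C (a : ℚ), by simp⟩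

theorem congr {f g : ℕ → ℕ} (hf : EventuallyPoly f) (h : f =ᶠ[atTop] g) : EventuallyPoly g := by
  obtain ⟨p, hp⟩ := hf
  refine ⟨p, ?_⟩
  filter_upwards [hp, h] with k h1 h2
  rw [← h2, h1]

theorem add {f g : ℕ → ℕ} (hf : EventuallyPoly f) (hg : EventuallyPoly g) :
    EventuallyPoly fun k => f k + g k := by
  obtain ⟨p, hp⟩ := hf
  obtain ⟨q, hq⟩ := hg
  refine ⟨p + q, ?_⟩
  filter_upwards [hp, hq] with k h1 h2
  simp [h1, h2]

theorem sum {f : ℕ → ℕ → ℕ} (hf : ∀ j, EventuallyPoly (f j)) (N : ℕ) :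
    EventuallyPoly fun k => ∑ j ∈ Finset.range N, f j k := by
  induction N with
  | zero => simpa using const 0
  | succ N ih =>
    simp only [Finset.sum_range_succ]
    exact ih.add (hf N)

theorem comp_sub {f : ℕ → ℕ} (hf : EventuallyPoly f) (j : ℕ) :
    EventuallyPoly fun k => f (k - j) := by
  obtain ⟨p, hp⟩ := hf
  refine ⟨p.comp (Polynomial.X - Polynomial.C (j : ℚ)), ?_⟩
  filter_upwards [(tendsto_sub_atTop_nat j).eventually hp, eventually_ge_atTop j] with k h1 h2
  rw [h1, Nat.cast_sub h2]
  simp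

theorem comp_succ {f : ℕ → ℕ} (hf : EventuallyPoly f) :
    EventuallyPoly fun k => f (k + 1) := by
  obtain ⟨p, hp⟩ := hf
  refine ⟨p.comp (Polynomial.X + 1), ?_⟩
  filter_upwards [(tendsto_add_atTop_nat 1).eventually hp] with k h1
  rw [h1]
  simp

theorem exists_eval_eq_sum_range (p : Polynomial ℚ) :
    ∃ q : Polynomial ℚ, ∀ k : ℕ, q.eval (k : ℚ) = ∑ i ∈ Finset.range k, p.eval (i : ℚ) := by
  induction p using Polynomial.induction_on' with
  | add p q hp hq =>
    obtain ⟨p', hp⟩ := hp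
    obtain ⟨q', hq⟩ := hq
    exact ⟨p' + q', fun k => by simp [hp, hq, Finset.sum_add_distrib]⟩
  | monomial e a =>
    refine ⟨Polynomial.C (a / (e + 1)) *
      (Polynomial.bernoulli e.succ - Polynomial.C (bernoulli e.succ)), fun k => ?_⟩
    have h := Polynomial.sum_range_pow_eq_bernoulli_sub k e
    have he : (e + 1 : ℚ) ≠ 0 := by positivity
    simp only [Polynomial.eval_mul, Polynomial.eval_C, Polynomial.eval_sub,
      Polynomial.eval_monomial]
    rw [← h, ← Finset.mul_sum]
    field_simp

theorem sum_range {f : ℕ → ℕ} (hf : EventuallyPoly f) :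
    EventuallyPoly fun k => ∑ i ∈ Finset.range k, f i := by
  obtain ⟨p, hp⟩ := hf
  obtain ⟨q, hq⟩ := exists_eval_eq_sum_range p
  obtain ⟨N, hN⟩ := eventually_atTop.1 hp
  refine ⟨q + Polynomial.C (∑ i ∈ Finset.range N, ((f i : ℚ) - p.eval (i : ℚ))), ?_⟩
  filter_upwards [eventually_ge_atTop N] with k hk
  obtain ⟨t, rfl⟩ := Nat.exists_eq_add_of_le hk
  simp only [Polynomial.eval_add, Polynomial.eval_C, hq, Finset.sum_range_add,
    Finset.sum_sub_distrib]
  push_cast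
  have : ∑ x ∈ Finset.range t, (f (N + x) : ℚ)
      = ∑ x ∈ Finset.range t, p.eval ((N : ℚ) + x) :=
    Finset.sum_congr rfl fun x _ => by rw [hN _ (Nat.le_add_right _ _), Nat.cast_add]
  rw [this]
  ring

/-- A function that is eventually polynomial and `O(k ^ n)` has a limit after division
by `k ^ n`. -/
theorem exists_tendsto_div_pow {f : ℕ → ℕ} (hf : EventuallyPoly f) (n : ℕ) (C : ℝ)
    (hC : ∀ᶠ k : ℕ in atTop, (f k : ℝ) ≤ C * (k : ℝ) ^ n) :
    ∃ a : ℝ, Tendsto (fun k : ℕ => (f k : ℝ) / (k : ℝ) ^ n) atTop (𝓝 a) := by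
  obtain ⟨p₀, hp₀⟩ := hf
  set p : Polynomial ℝ := p₀.map (algebraMap ℚ ℝ) with hpdef
  have hp : ∀ᶠ k : ℕ in atTop, (f k : ℝ) = p.eval (k : ℝ) := by
    filter_upwards [hp₀] with k hk
    have : ((f k : ℚ) : ℝ) = ((p₀.eval (k : ℚ) : ℚ) : ℝ) := by rw [hk]
    rw [hpdef, ← map_natCast (algebraMap ℚ ℝ) k, Polynomial.eval_map_algebraMap,
      Polynomial.aeval_algebraMap_apply]
    simpa using this
  have hX : (Polynomial.X ^ n : Polynomial ℝ) ≠ 0 := pow_ne_zero _ Polynomial.X_ne_zero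
  have key : ∃ a : ℝ, Tendsto (fun x : ℝ => p.eval x / (Polynomial.X ^ n : Polynomial ℝ).eval x)
      atTop (𝓝 a) := by
    rcases lt_trichotomy p.degree (Polynomial.X ^ n : Polynomial ℝ).degree with h | h | h
    · exact ⟨0, p.div_tendsto_atTop_zero_of_degree_lt _ h⟩
    · exact ⟨_, p.div_tendsto_atTop_leadingCoeff_div_of_degree_eq _ h⟩
    · exfalso
      have h1 := (p.abs_div_tendsto_atTop_atTop_of_degree_gt _ h hX).comp
        tendsto_natCast_atTop_atTop
      obtain ⟨k, h1, h2, h3, h4⟩ := ((h1.eventually_gt_atTop |C|).and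
        (hp.and (hC.and (eventually_gt_atTop 0)))).exists
      have hk : (0 : ℝ) < (k : ℝ) ^ n := by positivity
      simp only [Function.comp, Polynomial.eval_pow, Polynomial.eval_X] at h1
      rw [← h2, abs_of_nonneg (a := (f k : ℝ) / (k : ℝ) ^ n) (by positivity),
        lt_div_iff₀ hk] at h1
      have := mul_le_mul_of_nonneg_right (le_abs_self C) hk.le
      linarith
  obtain ⟨a, ha⟩ := key
  refine ⟨a, (ha.comp tendsto_natCast_atTop_atTop).congr' ?_⟩
  filter_upwards [hp] with k hk
  simp [hk]

end EventuallyPoly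

theorem finite_setOf_sum_lt {ι : Type*} [Fintype ι] (k : ℕ) :
    {m : ι → ℕ | ∑ i, m i < k}.Finite := by
  classical
  refine (Set.Finite.pi' fun _ : ι => Set.finite_Iic k).subset fun m hm i => ?_
  exact (Finset.single_le_sum (f := m) (fun _ _ => Nat.zero_le _) (Finset.mem_univ i)).trans hm.le

/-- The number of members of `B` of degree less than `k`. -/
noncomputable def degreeCount {ι : Type*} [Fintype ι] (B : Set (ι → ℕ)) (k : ℕ) : ℕ :=
  {m : ι → ℕ | m ∈ B ∧ ∑ i, m i < k}.ncard

theorem finite_degreeCount {ι : Type*} [Fintype ι] (B : Set (ι → ℕ)) (k : ℕ) :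
    {m : ι → ℕ | m ∈ B ∧ ∑ i, m i < k}.Finite :=
  (finite_setOf_sum_lt k).subset fun _ h => h.2

theorem exists_stable_of_antitone_isLowerSet {α : Type*} [Preorder α] [WellQuasiOrderedLE α]
    {B : ℕ → Set α} (hB : Antitone B) (hl : ∀ j, IsLowerSet (B j)) :
    ∃ N, ∀ j, N ≤ j → B j = B N := by
  by_contra! h
  have h' : ∀ N, ∃ j x, N ≤ j ∧ x ∈ B N ∧ x ∉ B j := by
    intro N
    obtain ⟨j, hj, hne⟩ := h N
    by_contra! hc
    exact hne (Set.Subset.antisymm (hB hj) fun x hx => hc j x hj hx)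
  choose j x hj hx hxj using h'
  have hmono : Monotone fun i => j^[i] 0 := monotone_nat_of_le_succ fun i => by
    rw [Function.iterate_succ_apply']
    exact hj _
  obtain ⟨a, b, hab, hle⟩ := wellQuasiOrdered_le fun i => x (j^[i] 0)
  refine hxj (j^[a] 0) (hl _ hle ?_)
  have := hB (hmono (Nat.succ_le_of_lt hab)) (hx (j^[b] 0))
  simpa only [Function.iterate_succ_apply'] using this

theorem degreeCount_eq_sum {d : ℕ} (B : Set (Fin (d + 1) → ℕ)) (k : ℕ) :
    degreeCount B k =
      ∑ j ∈ Finset.range k, degreeCount {m : Fin d → ℕ | (Fin.cons j m : Fin (d + 1) → ℕ) ∈ B}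
        (k - j) := by
  classical
  have hU : {m : Fin (d + 1) → ℕ | m ∈ B ∧ ∑ i, m i < k} =
      ⋃ j ∈ Finset.range k, (fun m : Fin d → ℕ => (Fin.cons j m : Fin (d + 1) → ℕ)) ''
        {m | (Fin.cons j m : Fin (d + 1) → ℕ) ∈ B ∧ ∑ i, m i < k - j} := by
    ext m
    simp only [Set.mem_ofPred_eq, Finset.mem_range, Set.mem_iUnion, Set.mem_image, exists_prop]
    constructor
    · rintro ⟨h1, h2⟩
      rw [Fin.sum_univ_succ] at h2
      refine ⟨m 0, by omega, Fin.tail m, ?_, Fin.cons_self_tail m⟩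
      rw [Fin.cons_self_tail]
      refine ⟨h1, ?_⟩
      simp only [Fin.tail]
      omega
    · rintro ⟨j, hj, m', ⟨h1, h2⟩, rfl⟩
      refine ⟨h1, ?_⟩
      rw [Fin.sum_univ_succ]
      simp only [Fin.cons_zero, Fin.cons_succ]
      omega
  have hinj : ∀ j : ℕ, Function.Injective
      fun m : Fin d → ℕ => (Fin.cons j m : Fin (d + 1) → ℕ) := fun j =>
    Fin.cons_right_injective (α := fun _ => ℕ) j
  rw [degreeCount, hU]
  refine (Set.Finite.ncard_biUnion (Finset.finite_toSet (Finset.range k)) ?_ ?_).trans ?_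
  · intro j _
    exact (finite_degreeCount _ _).image _
  · intro a _ b _ hab
    refine Set.disjoint_left.2 ?_
    rintro _ ⟨m, -, rfl⟩ ⟨m', -, h⟩
    have := congrFun h 0
    simp only [Fin.cons_zero] at this
    exact hab this.symm
  · rw [finsum_mem_coe_finset]
    refine Finset.sum_congr rfl fun j _ => ?_
    rw [Set.ncard_image_of_injective _ (hinj j)]
    rfl

/-- The degree counting function of a lower set of `ℕ ^ d` is eventually polynomial. -/
theorem eventuallyPoly_degreeCount_fin : ∀ {d : ℕ} {B : Set (Fin d → ℕ)}, IsLowerSet B →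
    EventuallyPoly (degreeCount B) := by
  intro d
  induction d with
  | zero =>
    intro B _
    refine (EventuallyPoly.const B.ncard).congr ?_
    filter_upwards [eventually_gt_atTop 0] with k hk
    simp [degreeCount, hk]
  | succ d ih =>
    intro B hB
    set S : ℕ → Set (Fin d → ℕ) := fun j => {m | (Fin.cons j m : Fin (d + 1) → ℕ) ∈ B} with hS
    have hSl : ∀ j, IsLowerSet (S j) := fun j a b hab ha =>
      hB (Fin.cons_le_cons.2 ⟨le_rfl, hab⟩) ha
    have hSa : Antitone S := fun i j hij a ha => hB (Fin.cons_le_cons.2 ⟨hij, le_rfl⟩) ha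
    obtain ⟨N, hN⟩ := exists_stable_of_antitone_isLowerSet hSa hSl
    have h1 : EventuallyPoly fun k => ∑ j ∈ Finset.range N, degreeCount (S j) (k - j) :=
      EventuallyPoly.sum (f := fun j k => degreeCount (S j) (k - j))
        (fun j => (ih (hSl j)).comp_sub j) N
    have h2 := ((ih (hSl N)).comp_succ.sum_range).comp_sub N
    refine (h1.add h2).congr ?_
    filter_upwards [eventually_ge_atTop N] with k hk
    obtain ⟨t, rfl⟩ := Nat.exists_eq_add_of_le hk
    rw [degreeCount_eq_sum, Finset.sum_range_add, Nat.add_sub_cancel_left,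
      ← Finset.sum_range_reflect (fun x => degreeCount {m : Fin d → ℕ |
        (Fin.cons (N + x) m : Fin (d + 1) → ℕ) ∈ B} (N + t - (N + x)))]
    congr 1
    refine Finset.sum_congr rfl fun x hx => ?_
    rw [Finset.mem_range] at hx
    have e1 : N + t - (N + (t - 1 - x)) = x + 1 := by omega
    rw [e1]
    change degreeCount (S N) _ = degreeCount (S (N + (t - 1 - x))) _
    rw [hN (N + (t - 1 - x)) (Nat.le_add_right _ _)]

theorem degreeCount_comp_equiv {ι κ : Type*} [Fintype ι] [Fintype κ] (e : ι ≃ κ)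
    (B : Set (ι → ℕ)) (k : ℕ) :
    degreeCount {m : κ → ℕ | m ∘ e ∈ B} k = degreeCount B k := by
  have h : {m : ι → ℕ | m ∈ B ∧ ∑ i, m i < k} =
      (fun m : κ → ℕ => m ∘ e) '' {m | m ∘ e ∈ B ∧ ∑ i, m i < k} := by
    ext m
    simp only [Set.mem_ofPred_eq, Set.mem_image]
    constructor
    · rintro ⟨h1, h2⟩
      refine ⟨m ∘ e.symm, ⟨?_, ?_⟩, ?_⟩
      · simpa [Function.comp_assoc] using h1
      · rwa [show ∑ i, (m ∘ e.symm) i = ∑ i, m i from Equiv.sum_comp e.symm m]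
      · simp [Function.comp_assoc]
    · rintro ⟨m', ⟨h1, h2⟩, rfl⟩
      refine ⟨h1, ?_⟩
      rwa [show ∑ i, (m' ∘ e) i = ∑ i, m' i from Equiv.sum_comp e m']
  rw [degreeCount, degreeCount, h,
    Set.ncard_image_of_injective _ e.surjective.injective_comp_right]
  rfl

theorem eventuallyPoly_degreeCount {ι : Type*} [Fintype ι] {B : Set (ι → ℕ)} (hB : IsLowerSet B) :
    EventuallyPoly (degreeCount B) := by
  have e := Fintype.equivFin ι
  have h : IsLowerSet {m : Fin (Fintype.card ι) → ℕ | m ∘ e ∈ B} :=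
    fun a b hab ha => hB (fun i => hab (e i)) ha
  refine (eventuallyPoly_degreeCount_fin h).congr (Eventually.of_forall fun k => ?_)
  exact degreeCount_comp_equiv e B k

theorem degreeCount_univ {ι : Type*} [Fintype ι] (k : ℕ) :
    degreeCount (Set.univ : Set (ι → ℕ)) (k + 1) =
      (k + Fintype.card ι).choose (Fintype.card ι) := by
  classical
  have h : {m : ι → ℕ | m ∈ Set.univ ∧ ∑ i, m i < k + 1} =
      (fun m (i : ι) => m (some i)) '' {m : Option ι → ℕ | ∑ i, m i = k} := by
    ext m
    simp only [Set.mem_univ, true_and, Set.mem_ofPred_eq, Set.mem_image]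
    constructor
    · intro hm
      refine ⟨fun o => o.elim (k - ∑ i, m i) m, ?_, rfl⟩
      rw [Fintype.sum_option]
      simp only [Option.elim]
      omega
    · rintro ⟨m', h, rfl⟩
      rw [Fintype.sum_option] at h
      exact Nat.lt_succ_of_le (h ▸ Nat.le_add_left _ _)
  rw [degreeCount, h, Set.InjOn.ncard_image, ← Nat.card_coe_set_eq]
  · have e : {m : Option ι → ℕ | ∑ i, m i = k} ≃ Sym (Option ι) k :=
      (Sym.equivNatSumOfFintype (Option ι) k).symm
    rw [Nat.card_congr e, Nat.card_eq_fintype_card, Sym.card_sym_eq_choose, Fintype.card_option,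
      ← Nat.choose_symm_add]
    congr 1
    omega
  · intro a ha b hb hab
    have hab' : ∀ i, a (some i) = b (some i) := fun i => congrFun hab i
    funext o
    cases o with
    | some i => exact hab' i
    | none =>
      simp only [Set.mem_ofPred_eq, Fintype.sum_option] at ha hb
      simp only [hab'] at ha
      omega

end Counting

section Length

theorem Module.length_eq_length_of_residueField {K A : Type*} [Field K] [CommRing A]
    [IsLocalRing A] [Algebra K A]
    (hK : Function.Surjective (algebraMap K (IsLocalRing.ResidueField A)))
    {M : Type*} [AddCommGroup M] [Module A M] (hM : IsFiniteLength A M)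
    [Module K M] [IsScalarTower K A M] : Module.length A M = Module.length K M := by
  rename_i i1 i2
  revert i1 i2
  induction hM with
  | of_subsingleton => intro _ _; simp
  | @of_simple_quotient M _ _ N hs hN ih =>
    intro _ _
    rw [Module.length_eq_add_of_exact N.subtype N.mkQ N.injective_subtype N.mkQ_surjective
        (LinearMap.exact_subtype_mkQ N),
      Module.length_eq_add_of_exact (N.subtype.restrictScalars K) (N.mkQ.restrictScalars K)
        N.injective_subtype N.mkQ_surjective (LinearMap.exact_subtype_mkQ N), ih]
    congr 1
    rw [Module.length_eq_one]
    obtain ⟨I, hI, ⟨e⟩⟩ := isSimpleModule_iff_quot_maximal.1 hs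
    obtain rfl := IsLocalRing.eq_maximalIdeal hI
    rw [(e.restrictScalars K).length_eq]
    change 1 = Module.length K (IsLocalRing.ResidueField A)
    rw [Module.length_eq_of_surjective (R := IsLocalRing.ResidueField A) hK, Module.length_eq_one]

theorem Module.length_eq_finrank_of_residueField {K A : Type*} [Field K] [CommRing A]
    [IsLocalRing A] [Algebra K A]
    (hK : Function.Surjective (algebraMap K (IsLocalRing.ResidueField A)))
    (M : Type*) [AddCommGroup M] [Module A M] [Module K M] [IsScalarTower K A M]
    [Module.Finite K M] : Module.length A M = Module.finrank K M := by
  rw [← Module.length_eq_finrank]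
  refine Module.length_eq_length_of_residueField hK (Module.length_ne_top_iff.1 ?_)
  have h := Submodule.length_le_length_restrictScalars K (⊤ : Submodule A M)
  rw [Submodule.restrictScalars_top, Module.length_top, Module.length_top,
    Module.length_eq_finrank] at h
  exact ne_top_of_le_ne_top (ENat.natCast_ne_top _) h

theorem ringKrullDim_le_of_isIntegral (R S : Type*) [CommRing R] [CommRing S] [Algebra R S]
    [Algebra.IsIntegral R S] [FaithfulSMul R S] : ringKrullDim R ≤ ringKrullDim S := by
  refine iSup_le fun l => ?_
  obtain ⟨⟨Q, hQ, hQl⟩⟩ := Ideal.nonempty_primesOver (S := S) l.head.asIdeal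
  obtain ⟨L, hL, -⟩ := Ideal.exists_ltSeries_of_hasGoingUp l Q
  rw [← hL]
  exact le_iSup (fun p : LTSeries (PrimeSpectrum S) => (p.length : WithBot ℕ∞)) L

end Length

namespace SpecialDatum

variable {n : ℕ} (𝔻 : SpecialDatum n)

section Tree

/-- The members of a special datum, ordered by inclusion. -/
abbrev Node : Type := {J : Finset (Fin n) // J ∈ 𝔻.D}

variable {𝔻}

theorem Node.lt_iff {K J : 𝔻.Node} : K < J ↔ K.1 ⊂ J.1 := Iff.rfl

theorem Node.comparable_of_mem {K J : 𝔻.Node} {i : Fin n} (hK : i ∈ K.1) (hJ : i ∈ J.1) :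
    K ≤ J ∨ J ≤ K := by
  rcases 𝔻.laminar K.1 K.2 J.1 J.2 with h | h | h
  · exact Or.inl h
  · exact Or.inr h
  · exact absurd hJ (Finset.disjoint_left.1 h hK)

theorem Node.le_of_covBy_of_lt {K J L : 𝔻.Node} (hJ : K ⋖ J) (hL : K < L) : J ≤ L := by
  obtain ⟨i, hi⟩ := 𝔻.nonempty_of_mem K.1 K.2
  rcases Node.comparable_of_mem (hJ.le hi : i ∈ J.1) (hL.le hi : i ∈ L.1) with h | h
  · exact h
  · rcases h.eq_or_lt with h | h
    · exact h.ge
    · exact absurd h (hJ.2 hL)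

theorem Node.eq_of_covBy {K J L : 𝔻.Node} (hJ : K ⋖ J) (hL : K ⋖ L) : J = L :=
  le_antisymm (le_of_covBy_of_lt hJ hL.lt) (le_of_covBy_of_lt hL hJ.lt)

theorem Node.eq_of_covBy_of_mem {K L J : 𝔻.Node} (hK : K ⋖ J) (hL : L ⋖ J) {i : Fin n}
    (hiK : i ∈ K.1) (hiL : i ∈ L.1) : K = L := by
  rcases Node.comparable_of_mem hiK hiL with h | h
  · exact h.eq_or_lt.resolve_right fun h => hK.2 h hL.lt
  · exact (h.eq_or_lt.resolve_right fun h => hL.2 h hK.lt).symm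

theorem Node.exists_covBy_mem {J : 𝔻.Node} {i : Fin n} (hi : i ∈ J.1) (hJ : J.1 ≠ {i}) :
    ∃ K : 𝔻.Node, K ⋖ J ∧ i ∈ K.1 := by
  have h : (⟨{i}, 𝔻.singleton_mem i⟩ : 𝔻.Node) < J := by
    rw [Node.lt_iff]
    exact (Finset.singleton_subset_iff.2 hi).ssubset_of_ne hJ.symm
  obtain ⟨K, hK, hKJ⟩ := exists_le_covBy_of_lt h
  exact ⟨K, hKJ, hK (Finset.mem_singleton_self i)⟩

theorem Node.w_eq_of_covBy {K L J : 𝔻.Node} (hK : K ⋖ J) (hL : L ⋖ J) :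
    𝔻.w K.1 = 𝔻.w L.1 :=
  𝔻.w_eq K.1 K.2 L.1 L.2 J.1 J.2
    ⟨hK.lt, fun M hM h => hK.2 (c := ⟨M, hM⟩) h.1 h.2⟩
    ⟨hL.lt, fun M hM h => hL.2 (c := ⟨M, hM⟩) h.1 h.2⟩

open Classical in
/-- The maximal members of `D` properly contained in `J`. -/
noncomputable def Node.children (J : 𝔻.Node) : Finset 𝔻.Node :=
  Finset.univ.filter (· ⋖ J)

theorem Node.mem_children {K J : 𝔻.Node} : K ∈ J.children ↔ K ⋖ J := by
  simp [Node.children]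

variable (𝔻) in
open Classical in
/-- The members of `D` that have children. -/
noncomputable def inner : Finset 𝔻.Node :=
  Finset.univ.filter fun J => J.children.Nonempty

theorem mem_inner {J : 𝔻.Node} : J ∈ 𝔻.inner ↔ J.children.Nonempty := by
  simp [inner]

theorem Node.exists_child_mem {J : 𝔻.Node} (hJ : J ∈ 𝔻.inner) {i : Fin n} (hi : i ∈ J.1) :
    ∃ K ∈ J.children, i ∈ K.1 := by
  obtain ⟨K, hK⟩ := mem_inner.1 hJ
  rw [mem_children] at hK
  have hne : J.1 ≠ {i} := by
    intro h
    have h1 : K.1 ⊂ {i} := h ▸ hK.lt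
    rw [Finset.ssubset_singleton_iff] at h1
    exact (𝔻.nonempty_of_mem K.1 K.2).ne_empty h1
  obtain ⟨L, hL, hiL⟩ := exists_covBy_mem hi hne
  exact ⟨L, mem_children.2 hL, hiL⟩

theorem notMem_inner_iff {J : 𝔻.Node} : J ∉ 𝔻.inner ↔ ∃ i, J.1 = {i} := by
  constructor
  · intro h
    obtain ⟨i, hi⟩ := 𝔻.nonempty_of_mem J.1 J.2
    refine ⟨i, ?_⟩
    by_contra hne
    obtain ⟨K, hK, -⟩ := Node.exists_covBy_mem hi hne
    exact h (mem_inner.2 ⟨K, Node.mem_children.2 hK⟩)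
  · rintro ⟨i, hi⟩ h
    obtain ⟨K, hK⟩ := mem_inner.1 h
    have h1 : K.1 ⊂ {i} := hi ▸ (Node.mem_children.1 hK).lt
    rw [Finset.ssubset_singleton_iff] at h1
    exact (𝔻.nonempty_of_mem K.1 K.2).ne_empty h1

theorem Node.two_le_card_children {J : 𝔻.Node} (hJ : J ∈ 𝔻.inner) : 2 ≤ J.children.card := by
  obtain ⟨K, hK⟩ := mem_inner.1 hJ
  obtain ⟨i, hiJ, hiK⟩ := Finset.exists_of_ssubset (mem_children.1 hK).lt
  obtain ⟨L, hL, hiL⟩ := exists_child_mem hJ hiJ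
  exact Finset.one_lt_card.2 ⟨K, hK, L, hL, fun h => hiK (h ▸ hiL)⟩

theorem Node.eq_of_mem_children {K J L : 𝔻.Node} (hJ : K ∈ J.children) (hL : K ∈ L.children) :
    J = L :=
  eq_of_covBy (mem_children.1 hJ) (mem_children.1 hL)

variable (𝔻)

theorem card_D_eq_add_card_inner : 𝔻.D.card = n + 𝔻.inner.card := by
  classical
  have h1 : (Finset.univ \ 𝔻.inner).card = n := by
    have : Finset.univ \ 𝔻.inner = Finset.univ.image
        fun i : Fin n => (⟨{i}, 𝔻.singleton_mem i⟩ : 𝔻.Node) := by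
      ext J
      simp only [Finset.mem_sdiff, Finset.mem_univ, true_and, notMem_inner_iff, Finset.mem_image]
      exact exists_congr fun i => ⟨fun h => Subtype.ext h.symm, fun h => by rw [← h]⟩
    rw [this, Finset.card_image_of_injective, Finset.card_univ, Fintype.card_fin]
    intro i j h
    simpa using h
  have h2 := Finset.card_sdiff_add_card_eq_card (Finset.subset_univ 𝔻.inner)
  rw [h1, Finset.card_univ, Fintype.card_coe] at h2
  exact h2.symm

theorem exists_card_D_eq_add_sum (hn : 1 ≤ n) :
    ∃ r, 1 ≤ r ∧ 𝔻.D.card = r + ∑ J ∈ 𝔻.inner, J.children.card := by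
  classical
  have h1 : ∑ J ∈ 𝔻.inner, J.children.card =
      (Finset.univ.filter fun K : 𝔻.Node => ¬ IsMax K).card := by
    rw [← Finset.card_biUnion]
    · congr 1
      ext K
      simp only [Finset.mem_biUnion, Finset.mem_filter, Finset.mem_univ, true_and]
      constructor
      · rintro ⟨J, -, hJ⟩
        exact (Node.mem_children.1 hJ).lt.not_isMax
      · intro h
        obtain ⟨J, hJ⟩ := exists_covBy_of_wellFoundedLT h
        exact ⟨J, mem_inner.2 ⟨K, Node.mem_children.2 hJ⟩, Node.mem_children.2 hJ⟩
    · intro J _ L _ hne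
      exact Finset.disjoint_left.2 fun K h1 h2 => hne (Node.eq_of_mem_children h1 h2)
  refine ⟨(Finset.univ.filter fun K : 𝔻.Node => IsMax K).card, ?_, ?_⟩
  · obtain ⟨K, -, hK⟩ := (Finset.univ : Finset 𝔻.Node).exists_le_maximal
      (Finset.mem_univ (⟨{⟨0, hn⟩}, 𝔻.singleton_mem _⟩ : 𝔻.Node))
    refine Finset.card_pos.2 ⟨K, ?_⟩
    simp only [Finset.mem_filter, Finset.mem_univ, true_and]
    exact fun L hL => hK.2 (Finset.mem_univ L) hL
  · rw [h1, Finset.card_filter_add_card_filter_not, Finset.card_univ, Fintype.card_coe]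

theorem card_children_eq_two (hn : 1 ≤ n) (h : 𝔻.D.card = 2 * n - 1) :
    ∀ J ∈ 𝔻.inner, J.children.card = 2 := by
  obtain ⟨r, hr, hr'⟩ := 𝔻.exists_card_D_eq_add_sum hn
  have h1 := 𝔻.card_D_eq_add_card_inner
  by_contra! hc
  obtain ⟨J, hJ, hne⟩ := hc
  have h2 : ∑ J ∈ 𝔻.inner, 2 < ∑ J ∈ 𝔻.inner, J.children.card :=
    Finset.sum_lt_sum (fun J hJ => Node.two_le_card_children hJ)
      ⟨J, hJ, lt_of_le_of_ne (Node.two_le_card_children hJ) hne.symm⟩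
  rw [Finset.sum_const, smul_eq_mul] at h2
  omega

theorem prod_card_children_eq (hn : 1 ≤ n) (h : 𝔻.D.card = 2 * n - 1) :
    ∏ J ∈ 𝔻.inner, J.children.card = 2 ^ (n - 1) := by
  have h1 := 𝔻.card_D_eq_add_card_inner
  rw [Finset.prod_congr rfl (𝔻.card_children_eq_two hn h), Finset.prod_const]
  congr 1
  omega

theorem prod_card_children_lt (hn : 1 ≤ n) (h : 𝔻.D.card ≠ 2 * n - 1) :
    ∏ J ∈ 𝔻.inner, J.children.card < 2 ^ (n - 1) := by
  obtain ⟨r, hr, hr'⟩ := 𝔻.exists_card_D_eq_add_sum hn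
  have h1 := 𝔻.card_D_eq_add_card_inner
  have h2 : ∑ J ∈ 𝔻.inner, J.children.card =
      ∑ J ∈ 𝔻.inner, (J.children.card - 1) + 𝔻.inner.card := by
    rw [Finset.card_eq_sum_ones, ← Finset.sum_add_distrib]
    refine Finset.sum_congr rfl fun J hJ => ?_
    have := Node.two_le_card_children hJ
    omega
  have hle : ∀ m : ℕ, 1 ≤ m → m ≤ 2 ^ (m - 1) := fun m hm => by
    have := (m - 1).lt_two_pow_self
    omega
  have hpos : ∀ J ∈ 𝔻.inner, 1 ≤ J.children.card := fun J hJ =>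
    (Node.two_le_card_children hJ).trans' one_le_two
  have h3 : ∏ J ∈ 𝔻.inner, 2 ^ (J.children.card - 1) = 2 ^ (n - r) := by
    rw [Finset.prod_pow_eq_pow_sum]
    congr 1
    omega
  by_cases hr1 : r = 1
  · have h4 : ∃ J ∈ 𝔻.inner, J.children.card ≠ 2 := by
      by_contra! hc
      rw [Finset.sum_congr rfl hc, Finset.sum_const, smul_eq_mul] at hr'
      omega
    obtain ⟨J, hJ, hne⟩ := h4
    have h5 : ∏ J ∈ 𝔻.inner, J.children.card < ∏ J ∈ 𝔻.inner, 2 ^ (J.children.card - 1) := by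
      refine Finset.prod_lt_prod (fun J hJ => hpos J hJ) (fun J hJ => hle _ (hpos J hJ))
        ⟨J, hJ, ?_⟩
      have h6 := Node.two_le_card_children hJ
      obtain ⟨m, hm⟩ : ∃ m, J.children.card = m + 3 := ⟨J.children.card - 3, by omega⟩
      rw [hm, show m + 3 - 1 = m + 2 by omega, pow_add]
      have := m.lt_two_pow_self
      omega
    rwa [h3, hr1] at h5
  · have hn2 : r ≤ n := by omega
    calc ∏ J ∈ 𝔻.inner, J.children.card ≤ ∏ J ∈ 𝔻.inner, 2 ^ (J.children.card - 1) :=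
          Finset.prod_le_prod' fun J hJ => hle _ (hpos J hJ)
      _ = 2 ^ (n - r) := h3
      _ < 2 ^ (n - 1) := Nat.pow_lt_pow_right (by norm_num) (by omega)

end Tree

end SpecialDatum

namespace SpecialDatum

variable {n : ℕ} {𝔻 : SpecialDatum n}

section Semigroup

/-- The exponent vector of the monomial `∏ J, (x_J ^ w(J)) ^ m(J)`. -/
noncomputable def expo (m : 𝔻.Node → ℕ) : Fin n →₀ ℕ :=
  Finsupp.equivFunOnFinite.symm fun i => ∑ J : 𝔻.Node, if i ∈ J.1 then m J * 𝔻.w J.1 else 0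

theorem expo_apply (m : 𝔻.Node → ℕ) (i : Fin n) :
    expo m i = ∑ J : 𝔻.Node, if i ∈ J.1 then m J * 𝔻.w J.1 else 0 := rfl

theorem expo_zero : expo (0 : 𝔻.Node → ℕ) = 0 := by
  ext i
  simp [expo_apply]

theorem expo_add (a b : 𝔻.Node → ℕ) : expo (a + b) = expo a + expo b := by
  ext i
  rw [Finsupp.add_apply, expo_apply, expo_apply, expo_apply, ← Finset.sum_add_distrib]
  refine Finset.sum_congr rfl fun J _ => ?_
  split_ifs
  · simp [add_mul]
  · rfl

theorem expo_single_apply [DecidableEq 𝔻.Node] (J : 𝔻.Node) (c : ℕ) (i : Fin n) :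
    expo (Pi.single J c : 𝔻.Node → ℕ) i = if i ∈ J.1 then c * 𝔻.w J.1 else 0 := by
  rw [expo_apply, Finset.sum_eq_single_of_mem J (Finset.mem_univ J), Pi.single_eq_same]
  intro L _ hL
  rw [Pi.single_eq_of_ne hL, zero_mul, ite_self]

theorem mul_w_le_expo (m : 𝔻.Node → ℕ) {J : 𝔻.Node} {i : Fin n} (hi : i ∈ J.1) :
    m J * 𝔻.w J.1 ≤ expo m i := by
  rw [expo_apply]
  refine le_trans ?_ (Finset.single_le_sum (fun _ _ => Nat.zero_le _) (Finset.mem_univ J))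
  simp [hi]

theorem finite_expo_fiber (s : Fin n →₀ ℕ) : {m : 𝔻.Node → ℕ | expo m = s}.Finite := by
  refine (Set.Finite.pi' fun J : 𝔻.Node => Set.finite_Iic (∑ i, s i)).subset ?_
  rintro m rfl J
  obtain ⟨i, hi⟩ := 𝔻.nonempty_of_mem J.1 J.2
  calc m J ≤ m J * 𝔻.w J.1 := Nat.le_mul_of_pos_right _ (𝔻.w_pos J.2)
    _ ≤ expo m i := mul_w_le_expo m hi
    _ ≤ ∑ i, expo m i :=
      Finset.single_le_sum (fun _ _ => Nat.zero_le _) (Finset.mem_univ i)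

variable (𝔻) in
/-- The exponents of monomials that are products of at least `k` generators. -/
def OrderGE (k : ℕ) (s : Fin n →₀ ℕ) : Prop :=
  ∃ m : 𝔻.Node → ℕ, expo m = s ∧ k ≤ ∑ J, m J

theorem OrderGE.add {k l : ℕ} {s t : Fin n →₀ ℕ} (hs : 𝔻.OrderGE k s) (ht : 𝔻.OrderGE l t) :
    𝔻.OrderGE (k + l) (s + t) := by
  obtain ⟨a, rfl, ha⟩ := hs
  obtain ⟨b, rfl, hb⟩ := ht
  refine ⟨a + b, expo_add a b, ?_⟩
  simp only [Pi.add_apply, Finset.sum_add_distrib]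
  exact add_le_add ha hb

variable (𝔻) in
/-- The exponents of monomials in `R_𝔻` that are not products of `k` generators and a monomial. -/
def orderLT (k : ℕ) : Set (Fin n →₀ ℕ) := {s | 𝔻.OrderGE 0 s ∧ ¬ 𝔻.OrderGE k s}

theorem orderLT_subset_image (k : ℕ) :
    𝔻.orderLT k ⊆ expo '' {m : 𝔻.Node → ℕ | ∑ J, m J < k} := by
  rintro s ⟨⟨m, rfl, -⟩, h⟩
  refine ⟨m, ?_, rfl⟩
  by_contra hk
  exact h ⟨m, rfl, not_lt.1 hk⟩

theorem finite_orderLT (k : ℕ) : (𝔻.orderLT k).Finite :=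
  ((finite_setOf_sum_lt k).image _).subset (orderLT_subset_image k)

/-- The degree of an exponent, refined by a lexicographic comparison. -/
noncomputable def degLexKey {ι : Type*} [Fintype ι] (m : ι → ℕ) :
    ℕ ×ₗ Lex (Fin (Fintype.card ι) → ℕ) :=
  toLex (∑ i, m i, toLex (m ∘ (Fintype.equivFin ι).symm))

theorem degLexKey_injective {ι : Type*} [Fintype ι] :
    Function.Injective (degLexKey (ι := ι)) := by
  intro a b h
  have h1 : a ∘ (Fintype.equivFin ι).symm = b ∘ (Fintype.equivFin ι).symm :=
    congrArg (fun x => ofLex (ofLex x).2) h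
  exact (Fintype.equivFin ι).symm.surjective.injective_comp_right h1

theorem degLexKey_add {ι : Type*} [Fintype ι] (a b : ι → ℕ) :
    degLexKey (a + b) = degLexKey a + degLexKey b := by
  simp only [degLexKey, Pi.add_apply, Finset.sum_add_distrib]
  rfl

theorem sum_le_of_degLexKey_le {ι : Type*} [Fintype ι] {a b : ι → ℕ}
    (h : degLexKey a ≤ degLexKey b) : ∑ i, a i ≤ ∑ i, b i := by
  rcases Prod.Lex.le_iff.1 h with h | h
  · exact le_of_lt h
  · exact le_of_eq h.1

variable (𝔻) in
/-- The exponents that are largest in their fibre over `ℕ ^ n`. -/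
def best : Set (𝔻.Node → ℕ) :=
  {m | ∀ m', expo m' = expo m → degLexKey m' ≤ degLexKey m}

theorem isLowerSet_best : IsLowerSet 𝔻.best := by
  intro a b hba ha b' hb'
  obtain ⟨c, rfl⟩ := exists_add_of_le hba
  have := ha (b' + c) (by rw [expo_add, expo_add, hb'])
  rw [degLexKey_add, degLexKey_add] at this
  exact le_of_add_le_add_right this

theorem ncard_orderLT_eq_degreeCount (k : ℕ) :
    (𝔻.orderLT k).ncard = degreeCount 𝔻.best k := by
  have h : 𝔻.orderLT k = expo '' {m | m ∈ 𝔻.best ∧ ∑ J, m J < k} := by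
    ext s
    constructor
    · rintro ⟨⟨m, hm, -⟩, hs⟩
      obtain ⟨m', hm', hmax⟩ := Set.exists_max_image {m : 𝔻.Node → ℕ | expo m = s} degLexKey
        (finite_expo_fiber s) ⟨m, hm⟩
      have hm'' : expo m' = s := hm'
      refine ⟨m', ⟨fun a ha => hmax a (ha.trans hm''), ?_⟩, hm''⟩
      by_contra hk
      exact hs ⟨m', hm'', not_lt.1 hk⟩
    · rintro ⟨m, ⟨hm, hk⟩, rfl⟩
      refine ⟨⟨m, rfl, Nat.zero_le _⟩, ?_⟩
      rintro ⟨m', hm', hk'⟩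
      exact absurd (hk'.trans (sum_le_of_degLexKey_le (hm m' hm'))) (not_le.2 hk)
  rw [h, degreeCount, Set.InjOn.ncard_image]
  rintro a ⟨ha, -⟩ b ⟨hb, -⟩ hab
  exact degLexKey_injective (le_antisymm (hb a hab) (ha b hab.symm))

theorem eventuallyPoly_ncard_orderLT : EventuallyPoly fun k => (𝔻.orderLT k).ncard :=
  (eventuallyPoly_degreeCount isLowerSet_best).congr
    (Eventually.of_forall fun k => (ncard_orderLT_eq_degreeCount k).symm)

end Semigroup

section NormalForm

variable (𝔻) in
/-- The exponents that omit at least one child of every member of `D` with children. -/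
def normal : Set (𝔻.Node → ℕ) :=
  {m | ∀ J ∈ 𝔻.inner, ∃ K ∈ J.children, m K = 0}

theorem Node.sum_children_ite {J : 𝔻.Node} (hJ : J ∈ 𝔻.inner) (i : Fin n) (a : ℕ) :
    (∑ K ∈ J.children, if i ∈ K.1 then a else 0) = if i ∈ J.1 then a else 0 := by
  classical
  split_ifs with hi
  · obtain ⟨K, hK, hiK⟩ := exists_child_mem hJ hi
    rw [Finset.sum_eq_single_of_mem K hK, if_pos hiK]
    intro L hL hne
    rw [if_neg]
    exact fun hiL => hne (eq_of_covBy_of_mem (mem_children.1 hL) (mem_children.1 hK) hiL hiK)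
  · refine Finset.sum_eq_zero fun K hK => if_neg fun hiK => hi ?_
    exact (mem_children.1 hK).le hiK

theorem Node.exists_w_children {J : 𝔻.Node} (hJ : J ∈ 𝔻.inner) :
    ∃ c, 2 ≤ c ∧ ∀ K ∈ J.children, 𝔻.w K.1 = c * 𝔻.w J.1 := by
  obtain ⟨K, hK⟩ := mem_inner.1 hJ
  have hKJ := mem_children.1 hK
  obtain ⟨c, hc⟩ := 𝔻.w_dvd K.1 K.2 J.1 J.2 hKJ.lt
  have hlt := 𝔻.w_lt K.1 K.2 J.1 J.2 hKJ.lt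
  refine ⟨c, ?_, fun L hL => ?_⟩
  · by_contra h
    have : c ≤ 1 := by omega
    have := Nat.mul_le_mul_left (𝔻.w J.1) this
    omega
  · rw [w_eq_of_covBy (mem_children.1 hL) hKJ, hc, mul_comm]

/-- Replacing the product of the children of `J` by a power of the generator at `J`. -/
theorem expo_children_eq {J : 𝔻.Node} (hJ : J ∈ 𝔻.inner) {c : ℕ}
    (hc : ∀ K ∈ J.children, 𝔻.w K.1 = c * 𝔻.w J.1) [DecidableEq 𝔻.Node] :
    expo (fun K => if K ∈ J.children then 1 else 0) = expo (Pi.single J c : 𝔻.Node → ℕ) := by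
  ext i
  rw [expo_apply, expo_single_apply, ← Node.sum_children_ite hJ,
    ← Finset.sum_subset (Finset.subset_univ J.children)]
  · refine Finset.sum_congr rfl fun K hK => ?_
    rw [if_pos hK, one_mul, hc K hK]
  · intro K _ hK
    rw [if_neg hK, zero_mul, ite_self]

theorem exists_normal (m : 𝔻.Node → ℕ) :
    ∃ m' ∈ 𝔻.normal, expo m' = expo m ∧
      ((∀ J ∈ 𝔻.inner, J.children.card = 2) → ∑ J, m J ≤ ∑ J, m' J) := by
  classical
  obtain ⟨m', ⟨h1, h2⟩, hmax⟩ := Set.exists_max_image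
    {m' : 𝔻.Node → ℕ | expo m' = expo m ∧
      ((∀ J ∈ 𝔻.inner, J.children.card = 2) → ∑ J, m J ≤ ∑ J, m' J)}
    (fun m' => ∑ J, m' J * J.1.card)
    ((finite_expo_fiber (expo m)).subset fun _ h => h.1) ⟨m, rfl, fun _ => le_rfl⟩
  refine ⟨m', ?_, h1, h2⟩
  by_contra hn
  simp only [normal, Set.mem_ofPred_eq] at hn
  push Not at hn
  obtain ⟨J, hJ, hne⟩ := hn
  obtain ⟨c, hc2, hc⟩ := Node.exists_w_children hJ
  set u : 𝔻.Node → ℕ := fun K => if K ∈ J.children then 1 else 0 with hu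
  have hle : u ≤ m' := by
    intro K
    simp only [hu]
    split_ifs with h
    · exact Nat.one_le_iff_ne_zero.2 (hne K h)
    · exact Nat.zero_le _
  obtain ⟨a, rfl⟩ := exists_add_of_le hle
  have hcard : ∑ K ∈ J.children, K.1.card = J.1.card := by
    have h3 : ∀ L : 𝔻.Node, L.1.card = ∑ i : Fin n, if i ∈ L.1 then 1 else 0 := fun L => by simp
    rw [h3 J, Finset.sum_congr rfl fun K _ => h3 K, Finset.sum_comm]
    exact Finset.sum_congr rfl fun i _ => Node.sum_children_ite hJ i 1
  have hJpos : 0 < J.1.card := (𝔻.nonempty_of_mem J.1 J.2).card_pos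
  have h4 := hmax (Pi.single J c + a) ⟨?_, ?_⟩
  · simp only [Pi.add_apply, add_mul, Finset.sum_add_distrib] at h4
    have h5 : ∑ K, u K * K.1.card = J.1.card := by
      simp only [hu, ite_mul, one_mul, zero_mul, Finset.sum_ite_mem, Finset.univ_inter, hcard]
    have h6 : ∑ K, (Pi.single J c : 𝔻.Node → ℕ) K * K.1.card = c * J.1.card := by
      rw [Finset.sum_eq_single_of_mem J (Finset.mem_univ J), Pi.single_eq_same]
      intro K _ hK
      rw [Pi.single_eq_of_ne hK, zero_mul]
    rw [h5, h6] at h4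
    nlinarith
  · rw [← h1, expo_add, expo_add, expo_children_eq hJ hc]
  · intro hbin
    have h5 := h2 hbin
    simp only [Pi.add_apply, Finset.sum_add_distrib, Finset.sum_pi_single', Finset.mem_univ,
      if_true] at h5 ⊢
    have h6 : ∑ K, u K = 2 := by
      rw [← hbin J hJ, hu, Finset.sum_ite_mem, Finset.univ_inter, Finset.card_eq_sum_ones]
    omega

theorem ncard_orderLT_le (k : ℕ) : (𝔻.orderLT k).ncard ≤ degreeCount 𝔻.normal k := by
  have h : 𝔻.orderLT k ⊆ expo '' {m | m ∈ 𝔻.normal ∧ ∑ J, m J < k} := by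
    rintro s ⟨⟨m, rfl, -⟩, hs⟩
    obtain ⟨m', hm', he, -⟩ := exists_normal m
    refine ⟨m', ⟨hm', ?_⟩, he⟩
    by_contra hk
    exact hs ⟨m', he, not_lt.1 hk⟩
  exact (Set.ncard_le_ncard h ((finite_degreeCount _ k).image _)).trans
    (Set.ncard_image_le (finite_degreeCount _ k))

open Classical in
/-- The total weight of the members of `D` containing `J`. -/
noncomputable def aboveSum (m : 𝔻.Node → ℕ) (J : 𝔻.Node) : ℕ :=
  ∑ K ∈ Finset.univ.filter (J ≤ ·), m K * 𝔻.w K.1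

theorem expo_apply_eq_sum_filter (m : 𝔻.Node → ℕ) (i : Fin n) :
    expo m i = ∑ K ∈ Finset.univ.filter (fun K : 𝔻.Node => i ∈ K.1), m K * 𝔻.w K.1 := by
  rw [expo_apply, Finset.sum_filter]

theorem aboveSum_le_expo (m : 𝔻.Node → ℕ) {J : 𝔻.Node} {i : Fin n} (hi : i ∈ J.1) :
    aboveSum m J ≤ expo m i := by
  classical
  rw [expo_apply_eq_sum_filter, aboveSum]
  refine Finset.sum_le_sum_of_subset fun K hK => ?_
  simp only [Finset.mem_filter, Finset.mem_univ, true_and] at hK ⊢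
  exact hK hi

theorem exists_expo_eq_aboveSum {m : 𝔻.Node → ℕ} (hm : m ∈ 𝔻.normal) (J : 𝔻.Node) :
    ∃ i ∈ J.1, expo m i = aboveSum m J := by
  classical
  induction J using WellFoundedLT.induction with
  | ind J ih =>
  by_cases hJ : J ∈ 𝔻.inner
  · obtain ⟨K, hK, hmK⟩ := hm J hJ
    have hKJ := Node.mem_children.1 hK
    obtain ⟨i, hi, he⟩ := ih K hKJ.lt
    refine ⟨i, hKJ.le hi, ?_⟩
    rw [he, aboveSum, aboveSum]
    symm
    refine Finset.sum_subset (fun L hL => ?_) fun L hL hL' => ?_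
    · simp only [Finset.mem_filter, Finset.mem_univ, true_and] at hL ⊢
      exact hKJ.le.trans hL
    · simp only [Finset.mem_filter, Finset.mem_univ, true_and] at hL hL'
      rcases hL.eq_or_lt with rfl | h
      · rw [hmK, zero_mul]
      · exact absurd (Node.le_of_covBy_of_lt hKJ h) hL'
  · obtain ⟨i, hi⟩ := notMem_inner_iff.1 hJ
    refine ⟨i, hi ▸ Finset.mem_singleton_self i, ?_⟩
    rw [expo_apply_eq_sum_filter, aboveSum]
    refine Finset.sum_congr (Finset.filter_congr fun K _ => ?_) fun _ _ => rfl
    rw [← Subtype.coe_le_coe, hi]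
    exact Finset.singleton_subset_iff.symm

theorem injOn_expo_normal : Set.InjOn expo 𝔻.normal := by
  classical
  have key : ∀ a ∈ 𝔻.normal, ∀ b ∈ 𝔻.normal, expo a = expo b →
      ∀ J, aboveSum a J ≤ aboveSum b J := by
    intro a _ b hb hab J
    obtain ⟨i, hi, he⟩ := exists_expo_eq_aboveSum hb J
    rw [← he, ← hab]
    exact aboveSum_le_expo a hi
  intro a ha b hb hab
  have h : ∀ J, aboveSum a J = aboveSum b J := fun J =>
    le_antisymm (key a ha b hb hab J) (key b hb a ha hab.symm J)
  funext J
  induction J using WellFoundedGT.induction with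
  | ind J ih =>
  have h1 := h J
  have h2 : (Finset.univ.filter fun K : 𝔻.Node => J ≤ K) =
      insert J (Finset.univ.filter fun K : 𝔻.Node => J < K) := by
    ext K
    simp only [Finset.mem_filter, Finset.mem_univ, true_and, Finset.mem_insert]
    rw [le_iff_eq_or_lt, eq_comm]
  rw [aboveSum, aboveSum, h2, Finset.sum_insert (by simp), Finset.sum_insert (by simp),
    Finset.sum_congr rfl fun K hK => by rw [ih K (by simpa using hK)]] at h1
  exact Nat.eq_of_mul_eq_mul_right (𝔻.w_pos J.2) (Nat.add_right_cancel h1)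

theorem degreeCount_normal_le (h2 : ∀ J ∈ 𝔻.inner, J.children.card = 2) (k : ℕ) :
    degreeCount 𝔻.normal k ≤ (𝔻.orderLT k).ncard := by
  refine Set.ncard_le_ncard_of_injOn expo ?_ (fun a ha b hb => injOn_expo_normal ha.1 hb.1)
    (finite_orderLT k)
  rintro m ⟨hm, hk⟩
  refine ⟨⟨m, rfl, Nat.zero_le _⟩, ?_⟩
  rintro ⟨m', he, hk'⟩
  obtain ⟨b, hb, hbe, hle⟩ := exists_normal m'
  obtain rfl := injOn_expo_normal hm hb (hbe.trans he).symm
  exact absurd (hk'.trans (hle h2)) (not_le.2 hk)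

end NormalForm

end SpecialDatum

section ZeroExtension

variable {ι : Type*} [DecidableEq ι]

/-- Extension by zero of a function defined off the finite set `Z`. -/
def zeroExtend (Z : Finset ι) (m : {i // i ∉ Z} → ℕ) (i : ι) : ℕ :=
  if h : i ∉ Z then m ⟨i, h⟩ else 0

theorem sum_zeroExtend [Fintype ι] (Z : Finset ι) (m : {i // i ∉ Z} → ℕ) :
    ∑ i, zeroExtend Z m i = ∑ i, m i := by
  rw [← Finset.sum_subset (Finset.subset_univ (Finset.univ.filter (· ∉ Z)))]
  · rw [Finset.sum_subtype (p := (· ∉ Z)) _ (by simp)]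
    exact Finset.sum_congr rfl fun i _ => dif_pos i.2
  · intro i _ hi
    exact dif_neg (by simpa using hi)

theorem zeroExtend_injective (Z : Finset ι) : Function.Injective (zeroExtend Z) := by
  intro a b h
  funext i
  have := congrFun h i.1
  rwa [zeroExtend, zeroExtend, dif_pos i.2, dif_pos i.2] at this

theorem ncard_zero_on_le [Fintype ι] (Z : Finset ι) (k : ℕ) :
    {m : ι → ℕ | (∀ i ∈ Z, m i = 0) ∧ ∑ i, m i < k}.ncard ≤
      degreeCount (Set.univ : Set ({i // i ∉ Z} → ℕ)) k := by
  refine (Set.ncard_le_ncard (t := zeroExtend Z '' {m | m ∈ Set.univ ∧ ∑ i, m i < k}) ?_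
    ((finite_degreeCount _ _).image _)).trans (Set.ncard_image_le (finite_degreeCount _ _))
  rintro m ⟨h1, h2⟩
  have h : zeroExtend Z (fun i => m i.1) = m := by
    funext i
    rw [zeroExtend]
    split_ifs with hi
    · exact (h1 i hi).symm
    · rfl
  refine ⟨_, ⟨Set.mem_univ _, ?_⟩, h⟩
  rwa [← sum_zeroExtend, h]

theorem le_ncard_zero_iff [Fintype ι] (Z : Finset ι) (k : ℕ) :
    degreeCount (Set.univ : Set ({i // i ∉ Z} → ℕ)) (k - Fintype.card {i // i ∉ Z}) ≤
      {m : ι → ℕ | (∀ i, m i = 0 ↔ i ∈ Z) ∧ ∑ i, m i < k}.ncard := by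
  refine Set.ncard_le_ncard_of_injOn (fun m => zeroExtend Z (m + 1)) ?_ ?_
    ((finite_setOf_sum_lt k).subset fun _ h => h.2)
  · rintro m ⟨-, hm⟩
    refine ⟨fun i => ?_, ?_⟩
    · simp only [zeroExtend]
      split_ifs with hi
      · simp [hi]
      · simpa using hi
    · rw [sum_zeroExtend]
      simp only [Pi.add_apply, Pi.one_apply, Finset.sum_add_distrib, Finset.sum_const,
        Finset.card_univ, smul_eq_mul, mul_one]
      omega
  · intro a _ b _ h
    exact add_right_cancel (zeroExtend_injective Z h)

end ZeroExtension

section Asymptotics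

theorem degreeCount_univ_le {ι : Type*} [Fintype ι] {k : ℕ} (hk : 1 ≤ k) :
    (degreeCount (Set.univ : Set (ι → ℕ)) k : ℝ) ≤
      ((k : ℝ) + Fintype.card ι) ^ Fintype.card ι / (Fintype.card ι).factorial := by
  obtain ⟨k, rfl⟩ := Nat.exists_eq_add_of_le' hk
  rw [degreeCount_univ]
  refine (Nat.choose_le_pow_div _ _).trans ?_
  gcongr
  push_cast
  linarith

theorem le_degreeCount_univ {ι : Type*} [Fintype ι] {k : ℕ} (hk : 1 ≤ k) :
    (k : ℝ) ^ Fintype.card ι / (Fintype.card ι).factorial ≤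
      degreeCount (Set.univ : Set (ι → ℕ)) k := by
  obtain ⟨k, rfl⟩ := Nat.exists_eq_add_of_le' hk
  rw [degreeCount_univ]
  refine le_trans ?_ (Nat.pow_le_choose _ _)
  rw [show k + Fintype.card ι + 1 - Fintype.card ι = k + 1 by omega]

theorem tendsto_add_const_pow_div_pow (n : ℕ) (c : ℝ) :
    Tendsto (fun k : ℕ => ((k : ℝ) + c) ^ n / (k : ℝ) ^ n) atTop (𝓝 1) := by
  have h : Tendsto (fun k : ℕ => (1 + c / (k : ℝ)) ^ n) atTop (𝓝 ((1 + 0) ^ n)) :=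
    ((tendsto_const_div_atTop_nhds_zero_nat c).const_add 1).pow n
  rw [add_zero, one_pow] at h
  refine h.congr' ?_
  filter_upwards [eventually_gt_atTop 0] with k hk
  have : (k : ℝ) ≠ 0 := by positivity
  rw [← div_pow, add_div, div_self this]

end Asymptotics

namespace SpecialDatum

variable {n : ℕ} (𝔻 : SpecialDatum n)

section NormalCount

open Classical in
/-- The members of `D` selected by a choice of a child for every member with children. -/
noncomputable def chosen (f : (J : 𝔻.Node) → J ∈ 𝔻.inner → 𝔻.Node) : Finset 𝔻.Node :=
  𝔻.inner.attach.image fun J => f J.1 J.2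

theorem mem_chosen {f : (J : 𝔻.Node) → J ∈ 𝔻.inner → 𝔻.Node} {K : 𝔻.Node} :
    K ∈ 𝔻.chosen f ↔ ∃ J hJ, f J hJ = K := by
  simp [chosen]

open Classical in
theorem card_notMem_chosen {f : (J : 𝔻.Node) → J ∈ 𝔻.inner → 𝔻.Node}
    (hf : f ∈ 𝔻.inner.pi fun J => J.children) :
    Fintype.card {K // K ∉ 𝔻.chosen f} = n := by
  have h1 : (𝔻.chosen f).card = 𝔻.inner.card := by
    rw [chosen, Finset.card_image_of_injective, Finset.card_attach]
    intro J L h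
    rw [Finset.mem_pi] at hf
    refine Subtype.ext (Node.eq_of_mem_children (hf J.1 J.2) ?_)
    have h' : f J.1 J.2 = f L.1 L.2 := h
    rw [h']
    exact hf L.1 L.2
  have h2 := 𝔻.card_D_eq_add_card_inner
  rw [Fintype.card_subtype_compl, Fintype.card_coe, Fintype.card_coe, h1]
  omega

theorem degreeCount_normal_le_prod {k : ℕ} (hk : 1 ≤ k) :
    (degreeCount 𝔻.normal k : ℝ) ≤
      (∏ J ∈ 𝔻.inner, J.children.card : ℕ) * (((k : ℝ) + n) ^ n / n.factorial) := by
  classical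
  have hsub : {m : 𝔻.Node → ℕ | m ∈ 𝔻.normal ∧ ∑ J, m J < k} ⊆
      ⋃ f ∈ 𝔻.inner.pi fun J => J.children,
        {m : 𝔻.Node → ℕ | (∀ K ∈ 𝔻.chosen f, m K = 0) ∧ ∑ J, m J < k} := by
    rintro m ⟨hm, hk⟩
    choose f hf hf0 using hm
    simp only [Set.mem_iUnion]
    refine ⟨f, Finset.mem_pi.2 hf, fun K hK => ?_, hk⟩
    obtain ⟨J, hJ, rfl⟩ := 𝔻.mem_chosen.1 hK
    exact hf0 J hJ
  have hfin : (⋃ f ∈ 𝔻.inner.pi fun J => J.children,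
        {m : 𝔻.Node → ℕ | (∀ K ∈ 𝔻.chosen f, m K = 0) ∧ ∑ J, m J < k}).Finite :=
    (finite_setOf_sum_lt k).subset (Set.iUnion₂_subset fun f _ m hm => hm.2)
  have h1 : degreeCount 𝔻.normal k ≤ ∑ f ∈ 𝔻.inner.pi fun J => J.children,
      degreeCount (Set.univ : Set ({K // K ∉ 𝔻.chosen f} → ℕ)) k :=
    ((Set.ncard_le_ncard hsub hfin).trans (Finset.set_ncard_biUnion_le _ _)).trans
      (Finset.sum_le_sum fun f _ => ncard_zero_on_le _ _)
  calc (degreeCount 𝔻.normal k : ℝ)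
      ≤ ∑ f ∈ 𝔻.inner.pi fun J => J.children,
          (degreeCount (Set.univ : Set ({K // K ∉ 𝔻.chosen f} → ℕ)) k : ℝ) := by
        exact_mod_cast h1
    _ ≤ ∑ f ∈ 𝔻.inner.pi fun J => J.children, ((k : ℝ) + n) ^ n / n.factorial := by
        refine Finset.sum_le_sum fun f hf => ?_
        have := degreeCount_univ_le (ι := {K // K ∉ 𝔻.chosen f}) hk
        rwa [𝔻.card_notMem_chosen hf] at this
    _ = _ := by rw [Finset.sum_const, Finset.card_pi, nsmul_eq_mul]

theorem prod_le_degreeCount_normal {k : ℕ} (hk : n < k) :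
    (∏ J ∈ 𝔻.inner, J.children.card : ℕ) * (((k : ℝ) - n) ^ n / n.factorial) ≤
      degreeCount 𝔻.normal k := by
  classical
  have hsub : (⋃ f ∈ 𝔻.inner.pi fun J => J.children,
        {m : 𝔻.Node → ℕ | (∀ K, m K = 0 ↔ K ∈ 𝔻.chosen f) ∧ ∑ J, m J < k}) ⊆
      {m : 𝔻.Node → ℕ | m ∈ 𝔻.normal ∧ ∑ J, m J < k} := by
    refine Set.iUnion₂_subset ?_
    rintro f hf m ⟨hm, hk⟩
    exact ⟨fun J hJ => ⟨f J hJ, Finset.mem_pi.1 hf J hJ,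
      (hm _).2 (𝔻.mem_chosen.2 ⟨J, hJ, rfl⟩)⟩, hk⟩
  have h1 : ∑ f ∈ 𝔻.inner.pi fun J => J.children,
      degreeCount (Set.univ : Set ({K // K ∉ 𝔻.chosen f} → ℕ)) (k - n) ≤
        degreeCount 𝔻.normal k := by
    refine le_trans ?_ (Set.ncard_le_ncard hsub (finite_degreeCount _ _))
    have h2 := Set.Finite.ncard_biUnion
      (Finset.finite_toSet (𝔻.inner.pi fun J => J.children))
      (s := fun f => {m : 𝔻.Node → ℕ | (∀ K, m K = 0 ↔ K ∈ 𝔻.chosen f) ∧ ∑ J, m J < k})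
      (fun f _ => (finite_setOf_sum_lt k).subset fun _ h => h.2) ?_
    · rw [finsum_mem_coe_finset] at h2
      refine le_trans (Finset.sum_le_sum fun f hf => ?_) h2.ge
      have := le_ncard_zero_iff (𝔻.chosen f) k
      rwa [𝔻.card_notMem_chosen hf] at this
    · intro f hf g hg hne
      refine Set.disjoint_left.2 ?_
      rintro m ⟨h1, -⟩ ⟨h2, -⟩
      apply hne
      rw [Finset.mem_coe, Finset.mem_pi] at hf hg
      funext J hJ
      obtain ⟨L, hL, he⟩ := 𝔻.mem_chosen.1
        ((h2 _).1 ((h1 _).2 (𝔻.mem_chosen.2 ⟨J, hJ, rfl⟩)))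
      obtain rfl := Node.eq_of_mem_children (hf J hJ) (he ▸ hg L hL)
      exact he.symm
  calc (∏ J ∈ 𝔻.inner, J.children.card : ℕ) * (((k : ℝ) - n) ^ n / n.factorial)
      = ∑ f ∈ 𝔻.inner.pi fun J => J.children, ((k : ℝ) - n) ^ n / n.factorial := by
        rw [Finset.sum_const, Finset.card_pi, nsmul_eq_mul]
    _ ≤ ∑ f ∈ 𝔻.inner.pi fun J => J.children,
          (degreeCount (Set.univ : Set ({K // K ∉ 𝔻.chosen f} → ℕ)) (k - n) : ℝ) := by
        refine Finset.sum_le_sum fun f hf => ?_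
        have := le_degreeCount_univ (ι := {K // K ∉ 𝔻.chosen f}) (k := k - n) (by omega)
        rwa [𝔻.card_notMem_chosen hf, Nat.cast_sub hk.le] at this
    _ ≤ degreeCount 𝔻.normal k := by exact_mod_cast h1

/-- The normalized count of exponents of order less than `k` converges, to a limit that is at most
the product of the numbers of children, and equal to it if all of these are two. -/
theorem exists_tendsto_ncard_orderLT :
    ∃ a : ℝ, Tendsto (fun k : ℕ => (n.factorial : ℝ) * (𝔻.orderLT k).ncard / (k : ℝ) ^ n)
        atTop (𝓝 a) ∧
      a ≤ (∏ J ∈ 𝔻.inner, J.children.card : ℕ) ∧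
      ((∀ J ∈ 𝔻.inner, J.children.card = 2) → a = (∏ J ∈ 𝔻.inner, J.children.card : ℕ)) := by
  have hupper := fun k (hk : 1 ≤ k) => 𝔻.degreeCount_normal_le_prod hk
  have hlower := fun k (hk : n < k) => 𝔻.prod_le_degreeCount_normal hk
  have hP0 : (0 : ℝ) ≤ (∏ J ∈ 𝔻.inner, J.children.card : ℕ) := Nat.cast_nonneg _
  generalize ((∏ J ∈ 𝔻.inner, J.children.card : ℕ) : ℝ) = P at hupper hlower hP0 ⊢
  have hn! : (0 : ℝ) < n.factorial := by positivity
  have hub : ∀ᶠ k : ℕ in atTop, (n.factorial : ℝ) * (𝔻.orderLT k).ncard / (k : ℝ) ^ n ≤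
      P * (((k : ℝ) + n) ^ n / (k : ℝ) ^ n) := by
    filter_upwards [eventually_ge_atTop 1] with k hk
    have h1 : ((𝔻.orderLT k).ncard : ℝ) ≤ P * (((k : ℝ) + n) ^ n / n.factorial) :=
      le_trans (by exact_mod_cast ncard_orderLT_le k) (hupper k hk)
    rw [← mul_div_assoc]
    refine div_le_div_of_nonneg_right ?_ (by positivity)
    calc (n.factorial : ℝ) * (𝔻.orderLT k).ncard
        ≤ n.factorial * (P * (((k : ℝ) + n) ^ n / n.factorial)) := by gcongr
      _ = P * ((k : ℝ) + n) ^ n := by field_simp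
  have hlimU : Tendsto (fun k : ℕ => P * (((k : ℝ) + n) ^ n / (k : ℝ) ^ n)) atTop (𝓝 P) := by
    simpa using (tendsto_add_const_pow_div_pow n (n : ℝ)).const_mul P
  have hlimL : Tendsto (fun k : ℕ => P * (((k : ℝ) - n) ^ n / (k : ℝ) ^ n)) atTop (𝓝 P) := by
    simpa [sub_eq_add_neg] using (tendsto_add_const_pow_div_pow n (-n : ℝ)).const_mul P
  obtain ⟨b, hb⟩ : ∃ b : ℝ, Tendsto (fun k : ℕ => ((𝔻.orderLT k).ncard : ℝ) / (k : ℝ) ^ n)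
      atTop (𝓝 b) := by
    refine (eventuallyPoly_ncard_orderLT (𝔻 := 𝔻)).exists_tendsto_div_pow n
      ((P + 1) / n.factorial) ?_
    filter_upwards [hub, hlimU.eventually_lt_const (lt_add_one P), eventually_gt_atTop 0]
      with k h1 h2 hk
    have hk' : (0 : ℝ) < (k : ℝ) ^ n := by positivity
    have h3 := h1.trans h2.le
    rw [div_le_iff₀ hk'] at h3
    rw [div_mul_eq_mul_div, le_div_iff₀ hn!]
    linarith
  have ha : Tendsto (fun k : ℕ => (n.factorial : ℝ) * (𝔻.orderLT k).ncard / (k : ℝ) ^ n)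
      atTop (𝓝 (n.factorial * b)) := by
    simpa [mul_div_assoc] using hb.const_mul (n.factorial : ℝ)
  have hle := le_of_tendsto_of_tendsto ha hlimU hub
  refine ⟨_, ha, hle, fun h2 => le_antisymm hle (le_of_tendsto_of_tendsto hlimL ha ?_)⟩
  filter_upwards [eventually_gt_atTop n] with k hk
  have h1 : P * (((k : ℝ) - n) ^ n / n.factorial) ≤ (𝔻.orderLT k).ncard :=
    (hlower k hk).trans (by exact_mod_cast degreeCount_normal_le h2 k)
  rw [← mul_div_assoc]
  refine div_le_div_of_nonneg_right ?_ (by positivity)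
  calc P * ((k : ℝ) - n) ^ n = n.factorial * (P * (((k : ℝ) - n) ^ n / n.factorial)) := by
        field_simp
    _ ≤ n.factorial * (𝔻.orderLT k).ncard := by gcongr

end NormalCount

end SpecialDatum

namespace SpecialDatum

variable {n : ℕ} (𝔻 : SpecialDatum n)

section Generators

variable {𝔻}

theorem eq_of_expo_eq_single [DecidableEq 𝔻.Node] {m : 𝔻.Node → ℕ} {J K : 𝔻.Node}
    (h : expo m = expo (Pi.single J 1 : 𝔻.Node → ℕ)) (hK : m K ≠ 0) : K = J := by
  have h1 : ∀ i ∈ K.1, i ∈ J.1 ∧ 𝔻.w K.1 ≤ 𝔻.w J.1 := by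
    intro i hi
    have h2 := mul_w_le_expo m hi
    have h3 := Nat.le_mul_of_pos_left (𝔻.w K.1) (Nat.pos_of_ne_zero hK)
    have h4 := 𝔻.w_pos K.2
    rw [h, expo_single_apply, one_mul] at h2
    split_ifs at h2 with hiJ
    · exact ⟨hiJ, h3.trans h2⟩
    · omega
  obtain ⟨i, hi⟩ := 𝔻.nonempty_of_mem K.1 K.2
  by_contra hne
  have hlt : K.1 ⊂ J.1 :=
    Finset.ssubset_iff_subset_ne.2 ⟨fun i hi => (h1 i hi).1, fun h => hne (Subtype.ext h)⟩
  exact absurd (𝔻.w_lt K.1 K.2 J.1 J.2 hlt) (not_lt.2 (h1 i hi).2)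

theorem sum_le_one_of_expo_eq_single [DecidableEq 𝔻.Node] {m : 𝔻.Node → ℕ} {J : 𝔻.Node}
    (h : expo m = expo (Pi.single J 1 : 𝔻.Node → ℕ)) : ∑ K, m K ≤ 1 := by
  rw [Finset.sum_eq_single_of_mem J (Finset.mem_univ J)
    fun K _ hK => by_contra fun h' => hK (eq_of_expo_eq_single h h')]
  obtain ⟨i, hi⟩ := 𝔻.nonempty_of_mem J.1 J.2
  have h2 := mul_w_le_expo m hi
  rw [h, expo_single_apply, if_pos hi] at h2
  exact Nat.le_of_mul_le_mul_right h2 (𝔻.w_pos J.2)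

theorem sum_eq_zero_of_expo_eq_zero {m : 𝔻.Node → ℕ} (h : expo m = 0) : ∑ K, m K = 0 := by
  refine Finset.sum_eq_zero fun K _ => ?_
  obtain ⟨i, hi⟩ := 𝔻.nonempty_of_mem K.1 K.2
  have h2 := mul_w_le_expo m hi
  rw [h, Finsupp.zero_apply, Nat.le_zero, mul_eq_zero] at h2
  exact h2.resolve_right (𝔻.w_pos K.2).ne'

variable (𝔻) in
theorem ncard_orderLT_two : (𝔻.orderLT 2).ncard = 𝔻.D.card + 1 := by
  classical
  have h : 𝔻.orderLT 2 =
      insert 0 (Set.range fun J : 𝔻.Node => expo (Pi.single J 1 : 𝔻.Node → ℕ)) := by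
    ext s
    constructor
    · intro hs
      obtain ⟨m, hm, rfl⟩ := orderLT_subset_image 2 hs
      have hm' : ∑ J, m J < 2 := hm
      by_cases h0 : ∀ J, m J = 0
      · left
        rw [show m = 0 from funext h0, expo_zero]
      · right
        push Not at h0
        obtain ⟨J, hJ⟩ := h0
        refine ⟨J, congrArg expo ?_⟩
        have h3 := Finset.add_sum_erase Finset.univ m (Finset.mem_univ J)
        have h4 : ∑ K ∈ Finset.univ.erase J, m K = 0 := by omega
        funext K
        by_cases hKJ : K = J
        · subst hKJ
          rw [Pi.single_eq_same]
          omega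
        · rw [Pi.single_eq_of_ne hKJ]
          exact (Finset.sum_eq_zero_iff.1 h4 K (Finset.mem_erase.2 ⟨hKJ, Finset.mem_univ K⟩)).symm
    · rintro (rfl | ⟨J, rfl⟩)
      · refine ⟨⟨0, expo_zero, Nat.zero_le _⟩, ?_⟩
        rintro ⟨m, hm, h2⟩
        rw [sum_eq_zero_of_expo_eq_zero hm] at h2
        omega
      · refine ⟨⟨_, rfl, Nat.zero_le _⟩, ?_⟩
        rintro ⟨m, hm, h2⟩
        have := sum_le_one_of_expo_eq_single hm
        omega
  have hinj : Function.Injective fun J : 𝔻.Node => expo (Pi.single J 1 : 𝔻.Node → ℕ) :=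
    fun J K h => eq_of_expo_eq_single h (by simp)
  rw [h, Set.ncard_insert_of_notMem _ (Set.finite_range _), ← Set.image_univ,
    Set.ncard_image_of_injective _ hinj, Set.ncard_univ, Nat.card_eq_fintype_card,
    Fintype.card_coe]
  rintro ⟨J, hJ⟩
  have := sum_eq_zero_of_expo_eq_zero hJ
  simp at this

theorem monomial_eq [DecidableEq 𝔻.Node] (J : 𝔻.Node) :
    𝔻.monomial J.1 = MvPolynomial.monomial (expo (Pi.single J 1 : 𝔻.Node → ℕ)) 1 := by
  have h : (∏ j ∈ J.1, (MvPolynomial.X j : MvPolynomial (Fin n) ℂ)) =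
      MvPolynomial.monomial (∑ j ∈ J.1, Finsupp.single j 1) 1 := by
    rw [MvPolynomial.monomial_sum_one]
    rfl
  rw [monomial, h, MvPolynomial.monomial_pow, one_pow]
  congr 2
  ext i
  rw [expo_single_apply, Finsupp.smul_apply, Finsupp.finsetSum_apply]
  simp [Finsupp.single_apply]

theorem monomial_expo_eq_prod (m : 𝔻.Node → ℕ) :
    MvPolynomial.monomial (expo m) (1 : ℂ) = ∏ J : 𝔻.Node, 𝔻.monomial J.1 ^ m J := by
  classical
  have h : expo m = ∑ J : 𝔻.Node, m J • expo (Pi.single J 1 : 𝔻.Node → ℕ) := by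
    ext i
    rw [expo_apply, Finsupp.finsetSum_apply]
    refine Finset.sum_congr rfl fun J _ => ?_
    rw [Finsupp.smul_apply, expo_single_apply]
    split_ifs <;> simp
  rw [h, MvPolynomial.monomial_sum_one]
  refine Finset.prod_congr rfl fun J _ => ?_
  rw [monomial_eq, MvPolynomial.monomial_pow, one_pow]

end Generators

section Order

/-- The generator of `R_𝔻` at a member of `D`. -/
noncomputable def gen (J : 𝔻.Node) : 𝔻.ring :=
  ⟨𝔻.monomial J.1, Algebra.subset_adjoin ⟨J.1, J.2, rfl⟩⟩

theorem gen_mem (J : 𝔻.Node) : 𝔻.gen J ∈ 𝔻.maxIdeal :=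
  Ideal.subset_span ⟨J.1, J.2, rfl⟩

variable {𝔻} in
theorem orderGE_zero_of_mem_support {p : MvPolynomial (Fin n) ℂ} (hp : p ∈ 𝔻.ring) :
    ∀ s ∈ p.support, 𝔻.OrderGE 0 s := by
  classical
  induction hp using Algebra.adjoin_induction with
  | mem x hx =>
    obtain ⟨J, hJ, rfl⟩ := hx
    intro s hs
    rw [monomial_eq ⟨J, hJ⟩] at hs
    rw [Finset.mem_singleton.1 (MvPolynomial.support_monomial_subset hs)]
    exact ⟨_, rfl, Nat.zero_le _⟩
  | algebraMap r =>
    intro s hs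
    rw [MvPolynomial.algebraMap_eq, MvPolynomial.C_apply] at hs
    rw [Finset.mem_singleton.1 (MvPolynomial.support_monomial_subset hs)]
    exact ⟨0, expo_zero, Nat.zero_le _⟩
  | add x y hx hy ihx ihy =>
    intro s hs
    rcases Finset.mem_union.1 (MvPolynomial.support_add hs) with h | h
    · exact ihx s h
    · exact ihy s h
  | mul x y hx hy ihx ihy =>
    intro s hs
    obtain ⟨a, ha, b, hb, rfl⟩ := Finset.mem_add.1 (MvPolynomial.support_mul x y hs)
    exact (ihx a ha).add (ihy b hb)

/-- The ideal of polynomials in `R_𝔻` all of whose monomials are products of at least `k`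
generators. -/
def orderIdeal (k : ℕ) : Ideal 𝔻.ring where
  carrier := {r | ∀ s ∈ (r : MvPolynomial (Fin n) ℂ).support, 𝔻.OrderGE k s}
  zero_mem' := by simp
  add_mem' := by
    classical
    intro a b ha hb s hs
    rcases Finset.mem_union.1 (MvPolynomial.support_add hs) with h | h
    · exact ha s h
    · exact hb s h
  smul_mem' := by
    classical
    intro c r hr s hs
    obtain ⟨a, ha, b, hb, rfl⟩ := Finset.mem_add.1 (MvPolynomial.support_mul _ _ hs)
    have := (orderGE_zero_of_mem_support c.2 a ha).add (hr b hb)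
    rwa [zero_add] at this

theorem mem_orderIdeal {k : ℕ} {r : 𝔻.ring} :
    r ∈ 𝔻.orderIdeal k ↔ ∀ s ∈ (r : MvPolynomial (Fin n) ℂ).support, 𝔻.OrderGE k s := Iff.rfl

theorem maxIdeal_pow_le_orderIdeal (k : ℕ) : 𝔻.maxIdeal ^ k ≤ 𝔻.orderIdeal k := by
  classical
  induction k with
  | zero => exact fun r _ => orderGE_zero_of_mem_support r.2
  | succ k ih =>
    rw [pow_succ, Ideal.mul_le]
    intro a ha b hb
    have hb1 : b ∈ 𝔻.orderIdeal 1 := by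
      refine (Ideal.span_le (I := 𝔻.orderIdeal 1)).2 ?_ hb
      rintro r ⟨J, hJ, hr⟩ s hs
      rw [hr, monomial_eq ⟨J, hJ⟩] at hs
      rw [Finset.mem_singleton.1 (MvPolynomial.support_monomial_subset hs)]
      exact ⟨_, rfl, by simp⟩
    intro s hs
    obtain ⟨x, hx, y, hy, rfl⟩ := Finset.mem_add.1 (MvPolynomial.support_mul _ _ hs)
    exact (ih ha x hx).add (hb1 y hy)

theorem exists_mem_maxIdeal_pow {k : ℕ} {s : Fin n →₀ ℕ} (hs : 𝔻.OrderGE k s) (c : ℂ) :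
    ∃ r ∈ 𝔻.maxIdeal ^ k, (r : MvPolynomial (Fin n) ℂ) = MvPolynomial.monomial s c := by
  obtain ⟨m, rfl, hk⟩ := hs
  refine ⟨algebraMap ℂ 𝔻.ring c * ∏ J, 𝔻.gen J ^ m J, ?_, ?_⟩
  · refine Ideal.mul_mem_left _ _ (Ideal.pow_le_pow_right hk ?_)
    rw [← Finset.prod_pow_eq_pow_sum]
    exact Ideal.prod_mem_prod fun J _ => Ideal.pow_mem_pow (𝔻.gen_mem J) _
  · rw [← mul_one c, ← MvPolynomial.C_mul_monomial, monomial_expo_eq_prod]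
    simp [gen, MvPolynomial.algebraMap_eq]

theorem orderIdeal_eq (k : ℕ) : 𝔻.orderIdeal k = 𝔻.maxIdeal ^ k := by
  refine le_antisymm (fun r hr => ?_) (𝔻.maxIdeal_pow_le_orderIdeal k)
  have h : (r : MvPolynomial (Fin n) ℂ) ∈
      ((𝔻.maxIdeal ^ k).restrictScalars ℂ).map 𝔻.ring.val.toLinearMap := by
    rw [← MvPolynomial.support_sum_monomial_coeff (r : MvPolynomial (Fin n) ℂ)]
    refine Submodule.sum_mem _ fun s hs => ?_
    obtain ⟨t, ht, he⟩ := 𝔻.exists_mem_maxIdeal_pow (hr s hs)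
      (MvPolynomial.coeff s (r : MvPolynomial (Fin n) ℂ))
    exact ⟨t, ht, he⟩
  obtain ⟨t, ht, he⟩ := h
  obtain rfl : t = r := Subtype.ext he
  exact ht

/-- The coefficients of the monomials that are not products of `k` generators and a monomial. -/
noncomputable def coeffMap (k : ℕ) : 𝔻.ring →ₗ[ℂ] (𝔻.orderLT k → ℂ) :=
  LinearMap.pi fun s => (MvPolynomial.lcoeff ℂ s.1).comp 𝔻.ring.val.toLinearMap

theorem coeffMap_apply (k : ℕ) (r : 𝔻.ring) (s : 𝔻.orderLT k) :
    𝔻.coeffMap k r s = MvPolynomial.coeff s.1 (r : MvPolynomial (Fin n) ℂ) := rfl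

theorem ker_coeffMap (k : ℕ) :
    LinearMap.ker (𝔻.coeffMap k) = (𝔻.maxIdeal ^ k).restrictScalars ℂ := by
  ext r
  rw [LinearMap.mem_ker, Submodule.restrictScalars_mem, ← orderIdeal_eq, mem_orderIdeal]
  constructor
  · intro h s hs
    by_contra hk
    refine MvPolynomial.mem_support_iff.1 hs ?_
    exact congrFun h ⟨s, orderGE_zero_of_mem_support r.2 s hs, hk⟩
  · intro h
    funext s
    rw [coeffMap_apply]
    by_contra hne
    exact s.2.2 (h s.1 (MvPolynomial.mem_support_iff.2 hne))

theorem coeffMap_surjective (k : ℕ) : Function.Surjective (𝔻.coeffMap k) := by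
  classical
  have := (finite_orderLT (𝔻 := 𝔻) k).fintype
  intro v
  choose t _ ht using fun s : 𝔻.orderLT k => 𝔻.exists_mem_maxIdeal_pow s.2.1 (v s)
  refine ⟨∑ s, t s, ?_⟩
  funext s
  rw [map_sum, Finset.sum_apply, Finset.sum_eq_single_of_mem s (Finset.mem_univ s)]
  · rw [coeffMap_apply, ht, MvPolynomial.coeff_monomial, if_pos rfl]
  · intro u _ hu
    rw [coeffMap_apply, ht, MvPolynomial.coeff_monomial, if_neg fun h => hu (Subtype.ext h)]

/-- The quotient of `R_𝔻` by the `k`-th power of `𝔪_𝔻` has a basis of monomials. -/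
noncomputable def quotEquiv (k : ℕ) : (𝔻.ring ⧸ 𝔻.maxIdeal ^ k) ≃ₗ[ℂ] (𝔻.orderLT k → ℂ) :=
  (Submodule.Quotient.restrictScalarsEquiv ℂ (𝔻.maxIdeal ^ k)).symm ≪≫ₗ
    Submodule.quotEquivOfEq _ _ (𝔻.ker_coeffMap k).symm ≪≫ₗ
    (𝔻.coeffMap k).quotKerEquivOfSurjective (𝔻.coeffMap_surjective k)

end Order

end SpecialDatum

theorem length_quotient_maximalIdeal_pow {K R A : Type*} [Field K] [CommRing R] [Algebra K R]
    (p : Ideal R) [p.IsMaximal] [CommRing A] [IsLocalRing A] [Algebra R A]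
    [IsLocalization.AtPrime A p] (k : ℕ) [Module.Finite K (R ⧸ p ^ k)]
    (hp : Function.Surjective (algebraMap K (R ⧸ p))) :
    Module.length A (A ⧸ IsLocalRing.maximalIdeal A ^ k) = Module.finrank K (R ⧸ p ^ k) := by
  let _ : Algebra K A := ((algebraMap R A).comp (algebraMap K R)).toAlgebra
  have : IsScalarTower K R A := IsScalarTower.of_algebraMap_eq fun _ => rfl
  have hK : Function.Surjective (algebraMap K (IsLocalRing.ResidueField A)) := by
    intro x
    obtain ⟨y, rfl⟩ := (IsLocalization.AtPrime.equivQuotMaximalIdeal p A).surjective x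
    obtain ⟨c, rfl⟩ := hp y
    refine ⟨c, ?_⟩
    rw [IsScalarTower.algebraMap_apply K R (R ⧸ p), Ideal.Quotient.algebraMap_eq,
      IsLocalization.AtPrime.equivQuotMaximalIdeal_apply_mk]
    rfl
  have e : (R ⧸ p ^ k) ≃ₗ[K] (A ⧸ IsLocalRing.maximalIdeal A ^ k) :=
    (IsLocalization.AtPrime.equivQuotMaximalIdealPow p A k).toLinearEquiv.restrictScalars K
  have := Module.Finite.equiv e
  rw [Module.length_eq_finrank_of_residueField hK, e.finrank_eq]

namespace SpecialDatum

variable {n : ℕ} (𝔻 : SpecialDatum n)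

section LocalRing

theorem evalZero_algebraMap (c : ℂ) : 𝔻.evalZero (algebraMap ℂ 𝔻.ring c) = c := by
  change MvPolynomial.constantCoeff (algebraMap ℂ (MvPolynomial (Fin n) ℂ) c) = c
  rw [MvPolynomial.algebraMap_eq, MvPolynomial.constantCoeff_C]

instance maxIdeal_isMaximal : 𝔻.maxIdeal.IsMaximal := by
  rw [maxIdeal_eq_ker]
  exact RingHom.ker_isMaximal_of_surjective _ fun c => ⟨_, 𝔻.evalZero_algebraMap c⟩

theorem length_quotient {A : Type*} [CommRing A] [IsLocalRing A] [Algebra 𝔻.ring A]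
    [IsLocalization.AtPrime A 𝔻.maxIdeal] (k : ℕ) :
    Module.length A (A ⧸ IsLocalRing.maximalIdeal A ^ k) = (𝔻.orderLT k).ncard := by
  have := (finite_orderLT (𝔻 := 𝔻) k).fintype
  have := Module.Finite.equiv (𝔻.quotEquiv k).symm
  rw [length_quotient_maximalIdeal_pow (K := ℂ) 𝔻.maxIdeal,
    (𝔻.quotEquiv k).finrank_eq, Module.finrank_fintype_fun_eq_card,
    ← Nat.card_eq_fintype_card, Nat.card_coe_set_eq]
  intro y
  obtain ⟨r, rfl⟩ := Ideal.Quotient.mk_surjective y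
  refine ⟨𝔻.evalZero r, ?_⟩
  change Ideal.Quotient.mk 𝔻.maxIdeal (algebraMap ℂ 𝔻.ring (𝔻.evalZero r)) = _
  rw [Ideal.Quotient.eq, maxIdeal_eq_ker, RingHom.mem_ker, map_sub, evalZero_algebraMap,
    sub_self]

end LocalRing

section Dimension

instance isIntegral_ring : Algebra.IsIntegral 𝔻.ring (MvPolynomial (Fin n) ℂ) := by
  refine ⟨fun p => ?_⟩
  induction p using MvPolynomial.induction_on with
  | C a => exact isIntegral_algebraMap (x := algebraMap ℂ 𝔻.ring a)
  | add p q hp hq => exact hp.add hq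
  | mul_X p i hp =>
    refine hp.mul (IsIntegral.of_pow (𝔻.w_pos (𝔻.singleton_mem i)) ?_)
    have h : (MvPolynomial.X i : MvPolynomial (Fin n) ℂ) ^ 𝔻.w {i} =
        algebraMap 𝔻.ring _ (𝔻.gen ⟨{i}, 𝔻.singleton_mem i⟩) := by
      change _ = 𝔻.monomial {i}
      rw [monomial, Finset.prod_singleton]
    rw [h]
    exact isIntegral_algebraMap

/-- The substitution that sends the first `k` variables to zero. -/
noncomputable def truncate (n k : ℕ) : MvPolynomial (Fin n) ℂ →ₐ[ℂ] MvPolynomial (Fin n) ℂ :=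
  MvPolynomial.aeval fun j => if j.1 < k then 0 else MvPolynomial.X j

theorem truncate_comp (n : ℕ) {k l : ℕ} (hkl : k ≤ l) (p : MvPolynomial (Fin n) ℂ) :
    truncate n l (truncate n k p) = truncate n l p := by
  rw [← AlgHom.comp_apply]
  congr 1
  ext j : 1
  simp only [AlgHom.comp_apply, truncate, MvPolynomial.aeval_X]
  split_ifs with h1 h2 h2
  · simp
  · omega
  · simp [h2]
  · simp [h2]

theorem truncate_self (n : ℕ) (p : MvPolynomial (Fin n) ℂ) :
    truncate n n p = MvPolynomial.C (MvPolynomial.constantCoeff p) := by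
  induction p using MvPolynomial.induction_on with
  | C a => simp [truncate]
  | add p q hp hq => rw [map_add, hp, hq, map_add, map_add]
  | mul_X p i _ => simp [truncate]

/-- The prime ideal of polynomials in `R_𝔻` that vanish when the first `k` variables do. -/
noncomputable def coordPrime (k : ℕ) : PrimeSpectrum 𝔻.ring :=
  ⟨RingHom.ker ((truncate n k).toRingHom.comp 𝔻.ring.val.toRingHom), RingHom.ker_isPrime _⟩

theorem mem_coordPrime {k : ℕ} {r : 𝔻.ring} :
    r ∈ (𝔻.coordPrime k).asIdeal ↔ truncate n k r = 0 := Iff.rfl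

theorem truncate_gen (k : ℕ) (i : Fin n) :
    truncate n k (𝔻.gen ⟨{i}, 𝔻.singleton_mem i⟩) =
      (if i.1 < k then 0 else MvPolynomial.X i) ^ 𝔻.w {i} := by
  change truncate n k (𝔻.monomial {i}) = _
  rw [monomial, Finset.prod_singleton, map_pow, truncate, MvPolynomial.aeval_X]

theorem coordPrime_lt {k : ℕ} (hk : k < n) : 𝔻.coordPrime k < 𝔻.coordPrime (k + 1) := by
  rw [← PrimeSpectrum.asIdeal_lt_asIdeal]
  refine SetLike.lt_iff_le_and_exists.2 ⟨fun r hr => ?_,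
    𝔻.gen ⟨{⟨k, hk⟩}, 𝔻.singleton_mem _⟩, ?_, ?_⟩
  · rw [mem_coordPrime] at hr ⊢
    rw [← truncate_comp n (Nat.le_succ k), hr, map_zero]
  · rw [mem_coordPrime, truncate_gen, if_pos (Nat.lt_succ_self k),
      zero_pow (𝔻.w_pos (𝔻.singleton_mem _)).ne']
  · rw [mem_coordPrime, truncate_gen, if_neg (lt_irrefl k)]
    exact pow_ne_zero _ (MvPolynomial.X_ne_zero _)

theorem coordPrime_self : (𝔻.coordPrime n).asIdeal = 𝔻.maxIdeal := by
  rw [maxIdeal_eq_ker]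
  ext r
  rw [mem_coordPrime, truncate_self, RingHom.mem_ker,
    map_eq_zero_iff _ (MvPolynomial.C_injective _ _)]
  rfl

theorem height_maxIdeal : 𝔻.maxIdeal.height = n := by
  apply le_antisymm
  · have h1 := Ideal.height_le_ringKrullDim_of_ne_top (maxIdeal_isPrime 𝔻).ne_top
    have h2 := ringKrullDim_le_of_isIntegral 𝔻.ring (MvPolynomial (Fin n) ℂ)
    rw [MvPolynomial.ringKrullDim_of_isNoetherianRing, ringKrullDim_eq_zero_of_field, zero_add,
      Nat.card_eq_fintype_card, Fintype.card_fin] at h2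
    exact_mod_cast h1.trans h2
  · let p : LTSeries (PrimeSpectrum 𝔻.ring) :=
      { length := n
        toFun := fun k => 𝔻.coordPrime k
        step := fun k => 𝔻.coordPrime_lt k.2 }
    have h := Order.length_le_height_last (p := p)
    have hl : p.last = ⟨𝔻.maxIdeal, 𝔻.maxIdeal_isPrime⟩ := PrimeSpectrum.ext 𝔻.coordPrime_self
    rw [hl, ← PrimeSpectrum.height_eq_orderHeight] at h
    exact h

end Dimension

theorem normalizedHilbertSamuel_eq {A : Type*} [CommRing A] [IsLocalRing A] [Algebra 𝔻.ring A]
    [IsLocalization.AtPrime A 𝔻.maxIdeal] (k : ℕ) : normalizedHilbertSamuel A k =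
    (n.factorial : ℝ) * (𝔻.orderLT k).ncard / (k : ℝ) ^ n := by
  have h : ((ringKrullDim A).unbotD 0).toNat = n := by
    rw [IsLocalization.AtPrime.ringKrullDim_eq_height 𝔻.maxIdeal, height_maxIdeal]
    rfl
  rw [normalizedHilbertSamuel, 𝔻.length_quotient, h, ENat.toNat_natCast]

end SpecialDatum

theorem length_cotangentSpace_add_one (A : Type*) [CommRing A] [IsLocalRing A] :
    Module.length A (IsLocalRing.CotangentSpace A) + 1 =
      Module.length A (A ⧸ IsLocalRing.maximalIdeal A ^ 2) := by
  set I := IsLocalRing.maximalIdeal A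
  have hI : I ^ 2 ≤ I := Ideal.pow_le_self two_ne_zero
  have h1 : Module.length A (A ⧸ I) = 1 := by
    rw [Module.length_eq_one_iff]
    exact isSimpleModule_iff_isCoatom.2 (IsLocalRing.maximalIdeal.isMaximal A).out
  rw [← h1]
  refine (Module.length_eq_add_of_exact I.cotangentToQuotientSquare (Submodule.factor hI)
    I.cotangentToQuotientSquare_injective (Submodule.factor_surjective hI) ?_).symm
  · intro x
    obtain ⟨a, rfl⟩ := Submodule.mkQ_surjective _ x
    constructor
    · intro h
      have ha : a ∈ I := (Submodule.Quotient.mk_eq_zero _).1 h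
      exact ⟨I.toCotangent ⟨a, ha⟩, rfl⟩
    · rintro ⟨y, hy⟩
      obtain ⟨b, rfl⟩ := I.toCotangent_surjective y
      rw [← hy, Ideal.toCotangent_to_quotient_square]
      exact (Submodule.Quotient.mk_eq_zero _).2 b.2

theorem embeddingDimension_eq_toNat_length (A : Type*) [CommRing A] [IsLocalRing A] :
    embeddingDimension A = (Module.length A (IsLocalRing.CotangentSpace A)).toNat := by
  rw [Module.length_eq_of_surjective (R := IsLocalRing.ResidueField A)
    IsLocalRing.residue_surjective, Module.length_eq_rank, Cardinal.toNat_toENat]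
  rfl

namespace SpecialDatum

theorem embeddingDimension_eq {n : ℕ} (𝔻 : SpecialDatum n) {A : Type*} [CommRing A]
    [IsLocalRing A] [Algebra 𝔻.ring A] [IsLocalization.AtPrime A 𝔻.maxIdeal] :
    embeddingDimension A = 𝔻.D.card := by
  have h := length_cotangentSpace_add_one A
  rw [𝔻.length_quotient, ncard_orderLT_two, Nat.cast_add, Nat.cast_one] at h
  rw [embeddingDimension_eq_toNat_length, WithTop.add_right_cancel (by exact ENat.one_ne_top) h,
    ENat.toNat_natCast]

end SpecialDatum

/-- The first conjunct says that the limit defining `e(R_𝔻)` exists. -/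
theorem mainTheorem9 (n : ℕ) (hn : 1 ≤ n) (𝔻 : SpecialDatum n) :
    Filter.Tendsto (normalizedHilbertSamuel 𝔻.LocalRing) Filter.atTop (nhds 𝔻.e) ∧
    𝔻.e ≤ 2 ^ (n - 1) ∧
    (𝔻.e = 2 ^ (n - 1) ↔ 𝔻.emb = 2 * n - 1) := by
  obtain ⟨a, ha, hle, heq⟩ := 𝔻.exists_tendsto_ncard_orderLT
  have ha' : Tendsto (normalizedHilbertSamuel 𝔻.LocalRing) atTop (𝓝 a) :=
    ha.congr fun k => (𝔻.normalizedHilbertSamuel_eq k).symm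
  have he : 𝔻.e = a := ha'.limUnder_eq
  have hemb : 𝔻.emb = 𝔻.D.card := 𝔻.embeddingDimension_eq
  rw [he, hemb]
  by_cases h : 𝔻.D.card = 2 * n - 1
  · have h1 := heq (𝔻.card_children_eq_two hn h)
    rw [𝔻.prod_card_children_eq hn h] at h1
    push_cast at h1
    exact ⟨ha', h1.le, iff_of_true h1 h⟩
  · have h1 : a < 2 ^ (n - 1) :=
      hle.trans_lt (by exact_mod_cast 𝔻.prod_card_children_lt hn h)
    exact ⟨ha', h1.le, iff_of_false h1.ne h⟩
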